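/- All manifolds are modelled on open subsets of $\mathbb R^{2n}$ (topological case) or $\mathbb C^n$ with holomorphic coordinate changes (complex case). The Hausdorff property and second countability are not needed. A complex structure on a topological space $M$ means a maximal holomorphic atlas of charts from open subsets of $M$ to open subsets of $\mathbb C^n$ that are homeomorphisms for the given topology of $M$. Open subsets of complex manifolds carry the induced complex structure. Let $n\ge 0$, let $X$ be a topological manifold of (real) dimension $2n$, and let $Y\subset X$ be an open subset endowed with the structure of a complex manifold of dimension $n$ (compatible with its subspace topology). Let $U$ be a complex manifold of dimension $n$, and let $f:U\to X$ be a continuous injective map such that - $X\setminus Y\subset \operatorname{im}(f)$, and - the restriction $f|_{f^{-1}(Y)}:f^{-1}(Y)\to Y$ is holomorphic, where $f^{-1}(Y)$ carries the complex structure induced from $U$. Then: 1. $\operatorname{im}(f)$ is open in $X$ and is a neighbourhood of $X\setminus Y$. 2. $f$ induces a homeomorphism $U\to\operatorname{im}(f)$. 3. $\operatorname{im}(f)\cap Y$ is open in $Y$ and $f$ induces a biholomorphism $f^{-1}(Y)\to \operatorname{im}(f)\cap Y$ with respect to the complex structures induced by the open embeddings $f^{-1}(Y)\subset U$ and $\operatorname{im}(f)\cap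 Y\subset Y$. 4. There exists a unique complex structure on $X$ (compatible with its given topology) whose restriction to $Y$ is the given complex structure of $Y$ and for which $f$ is a biholomorphism from $U$ onto the open subset $\operatorname{im}(f)\subset X$. -/

import Mathlib

open scoped Manifold ContDiff Topology
open TopologicalSpace (Opens)

/-- The maximal holomorphic atlas generated by a chart structure `c` modelled on `ℂⁿ`.
Over `ℂ`, the smoothness exponent `ω` means complex analytic, that is, holomorphic. Two chart
structures define the same complex structure exactly when these sets of charts are equal. -/
def holomorphicAtlas (n : ℕ) {M : Type*} [TopologicalSpace M]
    (c : ChartedSpace (EuclideanSpace ℂ (Fin n)) M) :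
    Set (OpenPartialHomeomorph M (EuclideanSpace ℂ (Fin n))) :=
  @IsManifold.maximalAtlas ℂ _ (EuclideanSpace ℂ (Fin n)) _ _ (EuclideanSpace ℂ (Fin n)) _
    𝓘(ℂ, EuclideanSpace ℂ (Fin n)) ω M _ c

/-- `c` makes the topological space `M` a complex manifold of dimension `n`: the charts take
values in `ℂⁿ` and the coordinate changes are holomorphic. -/
def IsComplexStructure (n : ℕ) {M : Type*} [TopologicalSpace M]
    (c : ChartedSpace (EuclideanSpace ℂ (Fin n)) M) : Prop :=
  @IsManifold ℂ _ (EuclideanSpace ℂ (Fin n)) _ _ (EuclideanSpace ℂ (Fin n)) _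
    𝓘(ℂ, EuclideanSpace ℂ (Fin n)) ω M _ c

/-- The chart structure induced on an open subset `Y` by a chart structure `c` on `M`. -/
noncomputable abbrev inducedCharts (n : ℕ) {M : Type*} [TopologicalSpace M]
    (c : ChartedSpace (EuclideanSpace ℂ (Fin n)) M) (Y : Opens M) :
    ChartedSpace (EuclideanSpace ℂ (Fin n)) Y :=
  @TopologicalSpace.Opens.instChartedSpace (EuclideanSpace ℂ (Fin n)) M _ _ c Y

/-- The complex structure `c` on `M` restricts to the complex structure `cY` on `Y`. -/
def ExtendsComplexStructure (n : ℕ) {M : Type*} [TopologicalSpace M] {Y : Opens M}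
    (cY : ChartedSpace (EuclideanSpace ℂ (Fin n)) Y)
    (c : ChartedSpace (EuclideanSpace ℂ (Fin n)) M) : Prop :=
  holomorphicAtlas n (inducedCharts n c Y) = holomorphicAtlas n cY

/-- The map `g` is holomorphic. -/
def IsHolomorphic (n : ℕ) {M N : Type*} [TopologicalSpace M] [TopologicalSpace N]
    [ChartedSpace (EuclideanSpace ℂ (Fin n)) M] [ChartedSpace (EuclideanSpace ℂ (Fin n)) N]
    (g : M → N) : Prop :=
  ContMDiff 𝓘(ℂ, EuclideanSpace ℂ (Fin n)) 𝓘(ℂ, EuclideanSpace ℂ (Fin n)) ω g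

/-- The set `S` is open in `N` and `g` induces a biholomorphism `M → S`, where `S` carries the
complex structure induced by the open embedding `S ⊆ N`. -/
def IsBiholomorphicOnto (n : ℕ) {M N : Type*} [TopologicalSpace M] [TopologicalSpace N]
    [ChartedSpace (EuclideanSpace ℂ (Fin n)) M] [ChartedSpace (EuclideanSpace ℂ (Fin n)) N]
    (g : M → N) (S : Set N) : Prop :=
  ∃ (hS : IsOpen S) (φ : M ≃ (⟨S, hS⟩ : Opens N)),
    IsHolomorphic n φ ∧ IsHolomorphic n φ.symm ∧ ∀ x, (φ x : N) = g x

/-- The restriction `f⁻¹(Y) → Y` of a continuous map `f : U → X` to the preimage of an open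
subset `Y` of `X`. -/
def restrictToPreimage {U X : Type*} [TopologicalSpace U] [TopologicalSpace X]
    (f : C(U, X)) (Y : Opens X) : ↥(Opens.comap f Y) → Y :=
  fun u => ⟨f u, u.2⟩

/-! ### No smooth retraction of a ball onto its sphere -/

section NoRetraction

open MeasureTheory Metric Set

variable {E : Type*} [NormedAddCommGroup E]

/-! Two classical theorems carry the result. Invariance of domain makes `f` an open embedding, which
gives the openness and homeomorphism claims. Osgood's theorem (an injective holomorphic map between
equal dimensions has invertible derivative) gives local holomorphic inverses of `f⁻¹(Y) → Y`, hence
the biholomorphism. Then `Y` and `U` cover `X` by open embeddings whose change of coordinates is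
holomorphic in both directions, so their charts glue. Between two such structures the identity is
holomorphic on both pieces, and its inverse is then holomorphic too, whence uniqueness.

Invariance of domain (`image_closedBall_mem_nhds`) rests on a Brouwer-type zero theorem, itself
deduced from `no_contDiff_retraction_sphere`, where the volume of the ball is computed as an
integral of a determinant polynomial in a parameter.

Osgood's theorem (`AnalyticAt.injective_fderiv_of_injOn`) goes by induction on dimension. Where the
derivative is nonzero, restriction to a level set of a coordinate of `f` lowers the dimension. So a
degenerate derivative must be zero; it then vanishes on the whole zero set of the Jacobian
determinant. That zero set contains a smooth hypersurface piece, along which `f` would be constant,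
against injectivity. -/

theorem exists_polynomial_eval_eq_det_one_add_smul [NormedSpace ℝ E] [FiniteDimensional ℝ E]
    (A : E →L[ℝ] E) :
    ∃ p : Polynomial ℝ, p.natDegree ≤ Module.finrank ℝ E ∧
      ∀ t : ℝ, p.eval t = (ContinuousLinearMap.id ℝ E + t • A).det := by
  let b := Module.finBasis ℝ E
  let M := LinearMap.toMatrix b b (A : E →ₗ[ℝ] E)
  refine ⟨Matrix.det ((Polynomial.X : Polynomial ℝ) • M.map Polynomial.C +
    (1 : Matrix _ _ ℝ).map Polynomial.C), ?_, fun t => ?_⟩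
  · simpa using Polynomial.natDegree_det_X_add_C_le M 1
  · rw [← Polynomial.coe_evalRingHom, RingHom.map_det, ContinuousLinearMap.det,
      ← LinearMap.det_toMatrix b]
    have h : LinearMap.toMatrix b b ((ContinuousLinearMap.id ℝ E + t • A : E →L[ℝ] E) : E →ₗ[ℝ] E) =
        1 + t • M := by
      rw [ContinuousLinearMap.toLinearMap_add, ContinuousLinearMap.toLinearMap_smul, map_add, map_smul]
      congr 1
      exact LinearMap.toMatrix_id b
    rw [h]
    congr 1
    clear_value M
    ext i j
    simp only [Matrix.one_apply, RingHom.mapMatrix_apply, Matrix.map_apply, Matrix.add_apply,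
      Matrix.smul_apply]
    split_ifs <;> simp <;> ring

/-- For `s ∈ [0, 1]` the map `1 + s A` is injective because `‖s A‖ < 1`, so the determinant never
vanishes on the path from `1` and keeps its positive sign. -/
theorem abs_det_id_add [NormedSpace ℝ E] [FiniteDimensional ℝ E]
    {A : E →L[ℝ] E} (hA : ‖A‖ < 1) : |(ContinuousLinearMap.id ℝ E + A).det| =
      (ContinuousLinearMap.id ℝ E + A).det := by
  have key : ∀ s ∈ Icc (0 : ℝ) 1, (ContinuousLinearMap.id ℝ E + s • A).det ≠ 0 := by
    intro s hs h0
    have hinj : Function.Injective (ContinuousLinearMap.id ℝ E + s • A) := by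
      rw [injective_iff_map_eq_zero]
      intro v hv
      by_contra hv0
      have h1 : v = - (s • A v) := by
        rw [eq_neg_iff_add_eq_zero]; simpa using hv
      have h2 : ‖v‖ ≤ ‖A‖ * ‖v‖ := by
        calc ‖v‖ = s * ‖A v‖ := by
              conv_lhs => rw [h1]
              rw [norm_neg, norm_smul, Real.norm_of_nonneg hs.1]
          _ ≤ 1 * ‖A v‖ := by gcongr; exact hs.2
          _ ≤ _ := by rw [one_mul]; exact A.le_opNorm v
      have := norm_pos_iff.2 hv0
      nlinarith
    have := LinearMap.bot_lt_ker_of_det_eq_zero (f := ((ContinuousLinearMap.id ℝ E + s • A : E →L[ℝ] E) : E →ₗ[ℝ] E)) h0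
    rw [LinearMap.ker_eq_bot.2 hinj] at this
    exact lt_irrefl _ this
  have hc : ContinuousOn (fun s : ℝ => (ContinuousLinearMap.id ℝ E + s • A).det) (Icc 0 1) :=
    (ContinuousLinearMap.continuous_det.comp (by fun_prop)).continuousOn
  rw [abs_eq_self]
  by_contra! hneg
  have := intermediate_value_Icc' (zero_le_one) hc
  obtain ⟨s, hs, hs0⟩ := this (show (0 : ℝ) ∈ _ by
    constructor
    · simpa using hneg.le
    · simp [ContinuousLinearMap.det])
  exact key s hs hs0

/-- This is a perturbation of the identity with Lipschitz constant `t * C < 1`, so the quantitative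
inverse function theorem applies on the whole space. The zero space is treated apart because there
`‖id‖` is not `1`. -/
theorem bijective_add_smul_of_lipschitz [NormedSpace ℝ E] [CompleteSpace E] {g : E → E} {C t : ℝ}
    (hg : ∀ x y, ‖g x - g y‖ ≤ C * ‖x - y‖) (hC : 0 ≤ C) (ht : 0 ≤ t) (htC : t * C < 1) :
    Function.Bijective fun x => x + t • g x := by
  rcases subsingleton_or_nontrivial E with h | h
  · exact ⟨fun _ _ _ => Subsingleton.elim _ _, fun x => ⟨x, Subsingleton.elim _ _⟩⟩
  have happ : ApproximatesLinearOn (fun x => x + t • g x)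
      ((ContinuousLinearEquiv.refl ℝ E : E ≃L[ℝ] E) : E →L[ℝ] E) univ (t * C).toNNReal := by
    intro x _ y _
    have : x + t • g x - (y + t • g y) - (x - y) = t • (g x - g y) := by
      rw [smul_sub]; abel
    simp only [ContinuousLinearEquiv.coe_coe, ContinuousLinearEquiv.coe_refl', id_eq, this,
      norm_smul, Real.norm_of_nonneg ht, Real.coe_toNNReal _ (mul_nonneg ht hC)]
    have := hg x y
    rw [mul_assoc]
    gcongr
  have hlt : (t * C).toNNReal <
      ‖((ContinuousLinearEquiv.refl ℝ E).symm : E →L[ℝ] E)‖₊⁻¹ := by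
    rw [ContinuousLinearEquiv.refl_symm, ContinuousLinearEquiv.coe_refl,
      ContinuousLinearMap.nnnorm_id, inv_one]
    exact Real.toNNReal_lt_one.2 htC
  exact ⟨injOn_univ.1 (happ.injOn (Or.inr hlt)), happ.surjective (Or.inr hlt)⟩

theorem image_eq_of_bijective_of_eqOn_compl {α : Type*} {h : α → α} (hb : Function.Bijective h)
    {s : Set α} (hs : ∀ x ∉ s, h x = x) : h '' s = s := by
  have h1 : h '' sᶜ = sᶜ := by
    conv_rhs => rw [← image_id sᶜ]
    exact image_congr hs
  rw [image_compl_eq hb] at h1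
  exact compl_injective h1

/-- The segment from `x` to `y` crosses the sphere; this carries a Lipschitz bound from the ball
across its boundary. -/
theorem exists_mem_segment_norm_eq [NormedSpace ℝ E] {x y : E} {R : ℝ} (hx : ‖x‖ ≤ R)
    (hy : R ≤ ‖y‖) : ∃ z, ‖z‖ = R ∧ ‖x - z‖ ≤ ‖x - y‖ := by
  have hc : ContinuousOn (fun s : ℝ => ‖x + s • (y - x)‖) (Icc 0 1) := by fun_prop
  obtain ⟨s, hs, h⟩ := intermediate_value_Icc zero_le_one hc
    (show R ∈ _ by constructor <;> simpa)
  refine ⟨_, h, ?_⟩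
  have : x - (x + s • (y - x)) = s • (x - y) := by module
  rw [this, norm_smul, Real.norm_of_nonneg hs.1]
  exact mul_le_of_le_one_left (norm_nonneg _) hs.2

/-- There is no `C¹` retraction of a closed ball onto its boundary sphere. -/
theorem no_contDiff_retraction_sphere [InnerProductSpace ℝ E] [FiniteDimensional ℝ E] {R : ℝ}
    (hR : 0 < R) {r : E → E} (hr : ContDiff ℝ 1 r) (hnorm : ∀ x, ‖r x‖ = R)
    (hid : ∀ x, ‖x‖ = R → r x = x) : False := by
  borelize E
  let B := closedBall (0 : E) R
  have hB : IsCompact B := isCompact_closedBall _ _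
  let g₀ : E → E := fun x => r x - x
  have hg₀ : ContDiff ℝ 1 g₀ := hr.sub contDiff_id
  have hdr := hr.differentiable one_ne_zero
  have hdg := hg₀.differentiable one_ne_zero
  have hcg : Continuous (fderiv ℝ g₀) := hg₀.continuous_fderiv one_ne_zero
  obtain ⟨C₀, hC₀⟩ := hB.exists_bound_of_continuousOn hcg.continuousOn
  obtain ⟨C, hC, hCpos⟩ : ∃ C, (∀ x ∈ B, ‖fderiv ℝ g₀ x‖ ≤ C) ∧ 0 < C :=
    ⟨max C₀ 1, fun x hx => (hC₀ x hx).trans (le_max_left _ _), by positivity⟩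
  -- Extension by zero is consistent on the sphere, where `r` is the identity. Hence `g` is globally
  -- Lipschitz, and `x + t g x` fixes the exterior and permutes the ball for small `t`.
  let g : E → E := fun x => if ‖x‖ ≤ R then g₀ x else 0
  have hgB : ∀ x, ‖x‖ ≤ R → g x = g₀ x := fun x hx => if_pos hx
  have hgB' : ∀ x, R ≤ ‖x‖ → g x = 0 := by
    intro x hx
    rcases hx.eq_or_lt with h | h
    · rw [hgB x h.ge]; simp [g₀, hid x h.symm]
    · exact if_neg h.not_ge
  have hlipB : ∀ x y, ‖x‖ ≤ R → ‖y‖ ≤ R → ‖g x - g y‖ ≤ C * ‖x - y‖ := by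
    intro x y hx hy
    rw [hgB x hx, hgB y hy]
    exact (convex_closedBall (0 : E) R).norm_image_sub_le_of_norm_fderiv_le
      (fun z _ => hdg z) hC (by simpa [B] using hy) (by simpa [B] using hx)
  have hlipX : ∀ x y, ‖x‖ ≤ R → R ≤ ‖y‖ → ‖g x - g y‖ ≤ C * ‖x - y‖ := by
    intro x y hx hy
    obtain ⟨z, hz, hxz⟩ := exists_mem_segment_norm_eq hx hy
    calc ‖g x - g y‖ = ‖g x - g z‖ := by rw [hgB' y hy, hgB' z hz.ge]
      _ ≤ C * ‖x - z‖ := hlipB x z hx hz.le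
      _ ≤ _ := by gcongr
  have hlip : ∀ x y, ‖g x - g y‖ ≤ C * ‖x - y‖ := by
    intro x y
    rcases le_total ‖x‖ R with hx | hx <;> rcases le_total ‖y‖ R with hy | hy
    · exact hlipB x y hx hy
    · exact hlipX x y hx hy
    · rw [norm_sub_rev, norm_sub_rev x]; exact hlipX y x hy hx
    · rw [hgB' x hx, hgB' y hy]; simp; positivity
  let D : ℝ → E → ℝ := fun t x => (ContinuousLinearMap.id ℝ E + t • fderiv ℝ g₀ x).det
  have hDc : ∀ t, Continuous (D t) := fun t =>
    ContinuousLinearMap.continuous_det.comp (by fun_prop)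
  have hint : ∀ t, IntegrableOn (D t) B volume := fun t =>
    (hDc t).continuousOn.integrableOn_compact hB
  -- Change of variables for a bijection of the ball onto itself; the determinant is its own
  -- absolute value since `‖t g₀'‖ < 1`.
  have hvol : ∀ t, 0 ≤ t → t * C < 1 → ∫ x in B, D t x = ∫ x in B, (1 : ℝ) := by
    intro t ht htC
    have hbij := bijective_add_smul_of_lipschitz hlip hCpos.le ht htC
    have him : (fun x => x + t • g x) '' B = B :=
      image_eq_of_bijective_of_eqOn_compl hbij fun x hx => by
        rw [hgB' x (by simpa [B] using (not_le.1 (by simpa [B] using hx)).le)]; simp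
    have hder : ∀ x ∈ B, HasFDerivWithinAt (fun x => x + t • g x)
        (ContinuousLinearMap.id ℝ E + t • fderiv ℝ g₀ x) B x := by
      intro x hx
      have h1 : HasFDerivWithinAt (fun x => x + t • g₀ x)
          (ContinuousLinearMap.id ℝ E + t • fderiv ℝ g₀ x) B x :=
        ((hasFDerivAt_id x).add ((hdg x).hasFDerivAt.const_smul t)).hasFDerivWithinAt
      exact h1.congr (fun y hy => by simp [hgB y (by simpa [B] using hy)])
        (by simp [hgB x (by simpa [B] using hx)])
    have := integral_image_eq_integral_abs_det_fderiv_smul volume hB.measurableSet hder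
      hbij.injective.injOn (fun _ => (1 : ℝ))
    rw [him] at this
    rw [this]
    refine setIntegral_congr_fun hB.measurableSet fun x hx => ?_
    have hlt : ‖t • fderiv ℝ g₀ x‖ < 1 := by
      rw [norm_smul, Real.norm_of_nonneg ht]
      exact (mul_le_mul_of_nonneg_left (hC x hx) ht).trans_lt htC
    simp only [D, smul_eq_mul, mul_one, abs_det_id_add hlt]
  -- the determinant is a polynomial in `t`, so it is determined by its values at small `t`
  let N := Module.finrank ℝ E + 1
  -- One node more than the degree bound, all satisfying `v i * C < 1` because `i < N`; Lagrange
  -- interpolation then reaches `t = 1`.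
  let v : ℕ → ℝ := fun i => i / (N * C)
  have hN : (0 : ℝ) < N := by positivity
  have hvinj : Set.InjOn v (Finset.range N) := by
    intro i _ j _ hij
    have : (N * C) ≠ 0 := by positivity
    simpa [v, div_left_inj' this] using hij
  let w : ℕ → ℝ := fun i => (Lagrange.basis (Finset.range N) v i).eval 1
  have hlag : ∀ p : Polynomial ℝ, p.natDegree < N →
      p.eval 1 = ∑ i ∈ Finset.range N, p.eval (v i) * w i := by
    intro p hp
    have hdeg : p.degree < (Finset.range N).card := by
      rw [Finset.card_range]
      exact lt_of_le_of_lt Polynomial.degree_le_natDegree (by exact_mod_cast hp)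
    conv_lhs => rw [Lagrange.eq_interpolate hvinj hdeg]
    simp [Lagrange.interpolate_apply, Polynomial.eval_finsetSum, w]
  have hw : ∑ i ∈ Finset.range N, w i = 1 := by
    have := hlag 1 (by simp [N])
    simpa using this.symm
  have hsum : ∀ x, D 1 x = ∑ i ∈ Finset.range N, D (v i) x * w i := by
    intro x
    obtain ⟨p, hp, hpe⟩ := exists_polynomial_eval_eq_det_one_add_smul (fderiv ℝ g₀ x)
    simp only [D, ← hpe]
    exact hlag p (Nat.lt_succ_of_le hp)
  have h1 : ∫ x in B, D 1 x = ∫ x in B, (1 : ℝ) := by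
    simp_rw [hsum]
    rw [integral_finsetSum _ fun i _ => (hint _).mul_const _]
    simp_rw [integral_mul_const]
    rw [Finset.sum_congr rfl fun i hi => by
      rw [hvol (v i) (by positivity) (by
        have : (i : ℝ) < N := by exact_mod_cast Finset.mem_range.1 hi
        simp only [v]
        rw [div_mul_eq_mul_div, div_lt_one (by positivity)]
        gcongr)]]
    rw [← Finset.mul_sum, hw, mul_one]
  -- At `t = 1` the determinant is that of `r'`. Since `‖r‖²` is constant, the image of `r'` is
  -- orthogonal to `r x ≠ 0`, so `r'` is not surjective.
  have h0 : ∀ x, D 1 x = 0 := by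
    intro x
    have hfd : fderiv ℝ g₀ x = fderiv ℝ r x - ContinuousLinearMap.id ℝ E := by
      simp only [g₀]
      rw [fderiv_fun_sub (hdr x) differentiableAt_fun_id, fderiv_fun_id]
    have hD : D 1 x = (fderiv ℝ r x).det := by simp [D, hfd]
    rw [hD]
    by_contra hne
    have hsurj : Function.Surjective (fderiv ℝ r x) := by
      have := (LinearMap.equivOfDetNeZero ((fderiv ℝ r x : E →L[ℝ] E) : E →ₗ[ℝ] E) hne).surjective
      exact this
    obtain ⟨u, hu⟩ := hsurj (r x)
    have hconst : (fun y => ‖r y‖ ^ 2) = fun _ => R ^ 2 := by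
      funext y; rw [hnorm]
    have h2 := ((hdr x).hasFDerivAt.norm_sq).fderiv
    rw [hconst] at h2
    have h3 := congrArg (fun L : E →L[ℝ] ℝ => L u) h2
    simp [hu, hnorm] at h3
    exact hR.ne' h3
  simp only [h0, integral_zero, setIntegral_const, smul_eq_mul, mul_one] at h1
  have hpos : 0 < volume.real B := by
    rw [Measure.real, ENNReal.toReal_pos_iff]
    exact ⟨measure_closedBall_pos _ _ hR, hB.measure_lt_top⟩
  exact hpos.ne h1

end NoRetraction

/-! ### Invariance of domain -/

section InvarianceOfDomain

open MeasureTheory Metric Set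

variable {E : Type*} [NormedAddCommGroup E] [InnerProductSpace ℝ E] [FiniteDimensional ℝ E]

/-- A zero-free `ψ` has a `C¹` approximation within `‖ψ‖`, still zero-free, and equal to `ψ` beyond
radius `R + 1`; normalizing it would retract onto that sphere. The gap between `R` and `R + 1`
supplies a neighbourhood on which `ψ` is already smooth. -/
theorem exists_eq_zero_of_continuous_of_eq_self {ψ : E → E} (hψ : Continuous ψ) {R : ℝ}
    (hR : 0 < R) (hid : ∀ x, R ≤ ‖x‖ → ψ x = x) : ∃ x, ψ x = 0 := by
  by_contra! hne
  have hS : IsClosed {x : E | R + 1 ≤ ‖x‖} := isClosed_le continuous_const continuous_norm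
  have hU : IsOpen {x : E | R < ‖x‖} := isOpen_lt continuous_const continuous_norm
  obtain ⟨g, hg, hgψ, hgS, -⟩ := hψ.exists_contDiff_approx_and_eqOn 1 hψ.norm
    (fun x => norm_pos_iff.2 (hne x)) hS
    (hU.mem_nhdsSet.2 fun x (hx : R + 1 ≤ ‖x‖) => show R < ‖x‖ by linarith)
    (contDiffOn_id.congr fun x (hx : R < ‖x‖) => hid x hx.le)
  have hg0 : ∀ x, g x ≠ 0 := by
    intro x hx
    have := hgψ x
    rw [hx, dist_zero_left] at this
    exact lt_irrefl _ this
  refine no_contDiff_retraction_sphere (R := R + 1) (by positivity)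
    (r := fun x => ((R + 1) / ‖g x‖) • g x) ?_ ?_ ?_
  · exact (contDiff_const.div (hg.norm ℝ hg0) fun x => norm_ne_zero_iff.2 (hg0 x)).smul hg
  · intro x
    have := norm_pos_iff.2 (hg0 x)
    rw [norm_smul, Real.norm_of_nonneg (by positivity)]
    field_simp
  · intro x hx
    have : g x = x := by
      rw [hgS (show R + 1 ≤ ‖x‖ from hx.ge), hid x (by linarith)]
    have h1 : R + 1 ≠ 0 := by positivity
    simp [this, hx, div_self h1]

/-- Extend `φ` radially outside the unit ball and blend it into the identity. No zero appears
outside: at a unit vector `u`, `‖φ u - u‖ ≤ 1` forces `⟪φ u, u⟫ ≥ 0`, so the blend has positive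
inner product with `u`. -/
theorem exists_eq_zero_of_norm_sub_self_le {φ : E → E} (hφ : ContinuousOn φ (closedBall 0 1))
    (hid : ∀ x, ‖x‖ ≤ 1 → ‖φ x - x‖ ≤ 1) : ∃ x, ‖x‖ ≤ 1 ∧ φ x = 0 := by
  by_contra! hne
  let P : E → E := fun x => (max 1 ‖x‖)⁻¹ • x
  have hmax : ∀ x : E, 0 < max 1 ‖x‖ := fun x => lt_max_of_lt_left one_pos
  have hP : Continuous P :=
    ((continuous_const.max continuous_norm).inv₀ fun x => (hmax x).ne').smul continuous_id
  have hPB : ∀ x, ‖P x‖ ≤ 1 := by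
    intro x
    rw [norm_smul, norm_inv, Real.norm_of_nonneg (hmax x).le, inv_mul_le_iff₀ (hmax x), mul_one]
    exact le_max_right _ _
  have hφP : Continuous fun x => φ (P x) :=
    hφ.comp_continuous hP fun x => by simpa using hPB x
  -- The blending weight rises from `0` to `1` as the norm goes from `1` to `2`.
  let s : E → ℝ := fun x => max 0 (min 1 (‖x‖ - 1))
  have hs : Continuous s := by fun_prop
  obtain ⟨x, hx⟩ := exists_eq_zero_of_continuous_of_eq_self
    (ψ := fun x => (1 - s x) • φ (P x) + s x • x)
    (((continuous_const.sub hs).smul hφP).add (hs.smul continuous_id)) two_pos (fun x hx => by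
      have : s x = 1 := by
        simp only [s]; rw [min_eq_left (by linarith), max_eq_right zero_le_one]
      simp [this])
  rcases le_or_gt ‖x‖ 1 with h | h
  · have h1 : s x = 0 := max_eq_left ((min_le_right _ _).trans (by linarith))
    have h2 : P x = x := by simp [P, max_eq_left h]
    exact hne x h (by simpa [h1, h2] using hx)
  · have hs0 : 0 < s x := lt_max_of_lt_right (lt_min one_pos (by linarith))
    have hs1 : s x ≤ 1 := max_le zero_le_one (min_le_left _ _)
    have hx0 : 0 < ‖x‖ := by linarith
    have hPx : P x = ‖x‖⁻¹ • x := by simp [P, max_eq_right h.le]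
    have hu : ‖P x‖ = 1 := by
      rw [hPx, norm_smul, norm_inv, norm_norm, inv_mul_cancel₀ hx0.ne']
    have hxu : x = ‖x‖ • P x := by rw [hPx, smul_smul, mul_inv_cancel₀ hx0.ne', one_smul]
    have h1 : 0 ≤ inner ℝ (φ (P x)) (P x) := by
      have h2 := norm_sub_sq_real (φ (P x)) (P x)
      have h3 := hid (P x) hu.le
      have h4 : ‖φ (P x) - P x‖ ^ 2 ≤ 1 := pow_le_one₀ (norm_nonneg _) h3
      rw [hu] at h2
      nlinarith [sq_nonneg ‖φ (P x)‖]
    have h2 := congrArg (fun y => inner ℝ y (P x)) hx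
    have h3 : inner ℝ x (P x) = ‖x‖ := by
      calc inner ℝ x (P x) = inner ℝ (‖x‖ • P x) (P x) := by rw [← hxu]
        _ = ‖x‖ := by rw [real_inner_smul_left, real_inner_self_eq_norm_sq, hu]; simp
    simp only [inner_add_left, real_inner_smul_left, h3, inner_zero_left] at h2
    have h4 : 0 < s x * ‖x‖ := by positivity
    have h5 : 0 ≤ (1 - s x) * inner ℝ (φ (P x)) (P x) := mul_nonneg (by linarith) h1
    linarith

/-- Otherwise some `c` near `f 0` is missed by the image. Extend `f⁻¹` to a continuous `G`, push the
image radially off a small ball about `c`, and replace `G` by a `C¹` perturbation `P - q` without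
zeros on the pushed image. The resulting self-map of the ball is within distance `1` of the identity
yet has no zero. -/
theorem image_closedBall_mem_nhds {f : E → E} (hf : ContinuousOn f (closedBall 0 1))
    (hinj : InjOn f (closedBall 0 1)) : f '' closedBall 0 1 ∈ 𝓝 (f 0) := by
  borelize E
  by_contra hK
  let B := closedBall (0 : E) 1
  have h0B : (0 : E) ∈ B := by simp [B]
  have hB : IsCompact B := isCompact_closedBall _ _
  have : CompactSpace B := isCompact_iff_compactSpace.1 hB
  have he : Topology.IsClosedEmbedding (B.domRestrict f) :=
    (continuousOn_iff_continuous_domRestrict.1 hf).isClosedEmbedding (injOn_iff_injective.1 hinj)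
  obtain ⟨G, hG⟩ := ContinuousMap.exists_extension' he (⟨Subtype.val, continuous_subtype_val⟩ : C(B, E))
  have hGf : ∀ x ∈ B, G (f x) = x := fun x hx => congrFun hG ⟨x, hx⟩
  have hG0 : G (f 0) = 0 := hGf 0 h0B
  obtain ⟨η, hη, hGη⟩ := Metric.continuousAt_iff.1 (G.continuous.continuousAt (x := f 0)) (1 / 10) (by norm_num)
  rw [hG0] at hGη
  simp only [dist_zero_right] at hGη
  -- The closed `ε`-ball about `c` then stays inside the `η`-ball about `f 0`, as `2 ε < η`.
  let ε := η / 3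
  have hε : 0 < ε := by positivity
  obtain ⟨c, hc, hcK⟩ : ∃ c, dist c (f 0) < ε ∧ c ∉ f '' B := by
    by_contra! h
    exact hK (Filter.mem_of_superset (ball_mem_nhds _ hε) fun y hy => h y hy)
  have hsmall : ∀ y, ‖y - c‖ ≤ ε → ‖G y‖ ≤ 1 / 10 := by
    intro y hy
    refine (hGη ?_).le
    calc dist y (f 0) ≤ dist y c + dist c (f 0) := dist_triangle _ _ _
      _ < ε + ε := add_lt_add_of_le_of_lt (by rwa [dist_eq_norm]) hc
      _ < η := by simp only [ε]; linarith
  have hKc : IsCompact (f '' B) := hB.image_of_continuousOn hf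
  -- The part of the image left in place. It omits `f 0`, the only image point where `G` vanishes,
  -- so by compactness `G` is bounded away from `0` on it.
  let S₁ := f '' B ∩ {y | ε ≤ ‖y - c‖}
  have hS₁ : IsCompact S₁ := hKc.inter_right (isClosed_le (by fun_prop) (by fun_prop))
  have hGS₁ : ∀ y ∈ S₁, 0 < ‖G y‖ := by
    rintro _ ⟨⟨x, hx, rfl⟩, hy⟩
    rw [norm_pos_iff, hGf x hx]
    rintro rfl
    rw [mem_ofPred_eq, ← dist_eq_norm, dist_comm] at hy
    linarith
  obtain ⟨δ, hδ, hδG⟩ := hS₁.exists_forall_le' (f := fun y => ‖G y‖) (a := 0)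
    (by fun_prop) hGS₁
  obtain ⟨δ', hδ', hδ'1, hδ'G⟩ : ∃ δ' : ℝ, 0 < δ' ∧ δ' ≤ 1 / 10 ∧ ∀ y ∈ S₁, δ' ≤ ‖G y‖ :=
    ⟨min δ (1 / 10), by positivity, min_le_right _ _, fun y hy => (min_le_left _ _).trans (hδG y hy)⟩
  obtain ⟨P, hP, hPG, -⟩ := G.continuous.exists_contDiff_approx 1
    (ε := fun _ => δ' / 2) continuous_const (fun _ => half_pos hδ')
  -- A `C¹` map sends the null sphere to a null set, so an arbitrarily small shift `q` makes `P - q`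
  -- zero-free there. This is why `G` had to be smoothed.
  have hnull : volume (P '' sphere c ε) = 0 :=
    addHaar_image_eq_zero_of_differentiableOn_of_addHaar_eq_zero volume
      (hP.differentiable one_ne_zero).differentiableOn
      (Measure.addHaar_sphere_of_ne_zero volume c hε.ne')
  obtain ⟨q, hq, hqP⟩ : ∃ q ∈ ball (0 : E) (δ' / 2), q ∉ P '' sphere c ε := by
    by_contra! h
    exact (measure_ball_pos volume (0 : E) (half_pos hδ')).ne'
      (measure_mono_null h hnull)
  have hPqG : ∀ y, ‖P y - q - G y‖ < δ' := by
    intro y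
    have h1 := hPG y
    rw [dist_eq_norm] at h1
    have h2 : ‖q‖ < δ' / 2 := by simpa using hq
    calc ‖P y - q - G y‖ = ‖(P y - G y) - q‖ := by congr 1; abel
      _ ≤ ‖P y - G y‖ + ‖q‖ := norm_sub_le _ _
      _ < δ' := by linarith
  -- Radial push away from `c`: the identity at distance at least `ε`, and projection onto the
  -- sphere inside; continuous on the image because `c` is not in it.
  let Φ : E → E := fun y => c + max (ε / ‖y - c‖) 1 • (y - c)
  have hne : ∀ y ∈ f '' B, ‖y - c‖ ≠ 0 := by
    intro y hy h
    rw [norm_eq_zero, sub_eq_zero] at h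
    exact hcK (h ▸ hy)
  have hΦ : ContinuousOn Φ (f '' B) := by
    refine continuousOn_const.add (ContinuousOn.smul ?_ (by fun_prop))
    exact ((continuousOn_const.div (by fun_prop) hne)).sup continuousOn_const
  have hΦ₁ : ∀ y ∈ f '' B, ε ≤ ‖y - c‖ → Φ y = y := by
    intro y hy hle
    have : ε / ‖y - c‖ ≤ 1 := div_le_one_of_le₀ hle (norm_nonneg _)
    simp [Φ, max_eq_right this]
  have hΦ₂ : ∀ y ∈ f '' B, ‖y - c‖ ≤ ε → ‖Φ y - c‖ = ε := by
    intro y hy hle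
    have h0 : 0 < ‖y - c‖ := (norm_nonneg _).lt_of_ne' (hne y hy)
    have : 1 ≤ ε / ‖y - c‖ := (one_le_div h0).2 hle
    simp only [Φ, max_eq_left this, add_sub_cancel_left, norm_smul, norm_div, norm_norm,
      Real.norm_of_nonneg hε.le]
    field_simp
  obtain ⟨x, hx, hx0⟩ := exists_eq_zero_of_norm_sub_self_le (φ := fun x => P (Φ (f x)) - q)
    ((hP.continuous.comp_continuousOn (hΦ.comp hf (mapsTo_image f B))).sub continuousOn_const) (by
      intro x hx
      have hxB : x ∈ B := by simpa [B] using hx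
      have hfx : f x ∈ f '' B := mem_image_of_mem f hxB
      have h1 := hPqG (Φ (f x))
      -- Far from `c` the error is below `δ' ≤ 1/10`. Near `c`, both `x` and `G (Φ (f x))` have norm
      -- at most `1/10`, for a total of at most `3/10`.
      rcases le_total ε ‖f x - c‖ with h | h
      · rw [hΦ₁ _ hfx h, hGf x hxB] at h1
        rw [hΦ₁ _ hfx h]
        linarith
      · have h2 := hsmall _ (hΦ₂ _ hfx h).le
        have h3 := hsmall _ h
        rw [hGf x hxB] at h3
        calc ‖P (Φ (f x)) - q - x‖ = ‖(P (Φ (f x)) - q - G (Φ (f x))) + G (Φ (f x)) - x‖ := by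
              congr 1; abel
          _ ≤ ‖P (Φ (f x)) - q - G (Φ (f x))‖ + ‖G (Φ (f x))‖ + ‖x‖ :=
              (norm_sub_le _ _).trans (by gcongr; exact norm_add_le _ _)
          _ ≤ 1 := by linarith)
  have hxB : x ∈ B := by simpa [B] using hx
  have hfx : f x ∈ f '' B := mem_image_of_mem f hxB
  rcases le_total ε ‖f x - c‖ with h | h
  · have h1 := hPqG (Φ (f x))
    rw [hx0, hΦ₁ _ hfx h, zero_sub, norm_neg] at h1
    exact absurd (hδ'G _ ⟨hfx, h⟩) h1.not_ge
  · exact hqP ⟨Φ (f x), by simpa [dist_eq_norm] using hΦ₂ _ hfx h, sub_eq_zero.1 hx0⟩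

/-- **Invariance of domain.** -/
theorem ContinuousOn.image_mem_nhds_of_injOn {V W : Type*} [NormedAddCommGroup V] [NormedSpace ℝ V]
    [FiniteDimensional ℝ V] [NormedAddCommGroup W] [NormedSpace ℝ W] [FiniteDimensional ℝ W]
    (hdim : Module.finrank ℝ V = Module.finrank ℝ W) {f : V → W} {s : Set V}
    (hf : ContinuousOn f s) (hinj : InjOn f s) {x : V} (hs : s ∈ 𝓝 x) : f '' s ∈ 𝓝 (f x) := by
  let m := Module.finrank ℝ V
  let L : EuclideanSpace ℝ (Fin m) ≃L[ℝ] V := ContinuousLinearEquiv.ofFinrankEq (by simp [m])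
  let L' : W ≃L[ℝ] EuclideanSpace ℝ (Fin m) := ContinuousLinearEquiv.ofFinrankEq (by simp [m, hdim])
  have hcont : Continuous fun z : EuclideanSpace ℝ (Fin m) => x + L z := by fun_prop
  have hpre : (fun z => x + L z) ⁻¹' s ∈ 𝓝 (0 : EuclideanSpace ℝ (Fin m)) :=
    hcont.continuousAt.preimage_mem_nhds (by simpa using hs)
  obtain ⟨ρ, hρ, hρs⟩ := Metric.nhds_basis_closedBall.mem_iff.1 hpre
  let a : EuclideanSpace ℝ (Fin m) → V := fun z => x + L (ρ • z)
  have ha : MapsTo a (closedBall 0 1) s := by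
    intro z hz
    refine hρs (a := ρ • z) ?_
    have : ‖z‖ ≤ 1 := by simpa using hz
    simpa [norm_smul, abs_of_pos hρ] using mul_le_of_le_one_right hρ.le this
  have hainj : Function.Injective a := fun z z' h =>
    smul_right_injective _ hρ.ne' (L.injective (add_left_cancel h))
  have key := image_closedBall_mem_nhds (f := fun z => L' (f (a z)))
    (L'.continuous.comp_continuousOn (hf.comp (by fun_prop) ha))
    (L'.injective.injOn.comp (hinj.comp hainj.injOn ha) (mapsTo_univ _ _))
  have h2 := (L'.continuous.continuousAt (x := f x)).preimage_mem_nhds (by simpa [a] using key)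
  refine Filter.mem_of_superset h2 ?_
  rintro w ⟨z, hz, hzw⟩
  exact ⟨a z, ha hz, L'.injective (by simpa [a] using hzw)⟩

end InvarianceOfDomain

/-! ### Zero sets of holomorphic functions -/

section InjectiveHolomorphic

open Metric Set Filter

variable {E F : Type*} [NormedAddCommGroup E] [NormedSpace ℂ E]
  [NormedAddCommGroup F] [NormedSpace ℂ F]

theorem AnalyticAt.clm_det [FiniteDimensional ℂ E] {A : F → E →L[ℂ] E} {p : F}
    (hA : AnalyticAt ℂ A p) : AnalyticAt ℂ (fun z => (A z).det) p := by
  let b := Module.finBasis ℂ E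
  have h : (fun z => (A z).det) = fun z => ∑ σ : Equiv.Perm (Fin (Module.finrank ℂ E)),
      ((Equiv.Perm.sign σ : ℤ) : ℂ) * ∏ i, b.repr (A z (b i)) (σ i) := by
    funext z
    rw [ContinuousLinearMap.det, ← LinearMap.det_toMatrix b, Matrix.det_apply']
    simp [LinearMap.toMatrix_apply]
  rw [h]
  refine Finset.analyticAt_fun_sum _ fun σ _ => analyticAt_const.mul ?_
  refine Finset.analyticAt_fun_prod _ fun i _ => ?_
  have h1 : AnalyticAt ℂ (fun z => A z (b i)) p :=
    ((ContinuousLinearMap.apply ℂ E (b i)).analyticAt _).comp hA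
  exact ((LinearMap.toContinuousLinearMap (b.coord (σ i))).analyticAt _).comp h1

theorem AnalyticAt.comp_line {h : E → F} {q e : E} {t : ℂ} (hh : AnalyticAt ℂ h (q + t • e)) :
    AnalyticAt ℂ (fun t : ℂ => h (q + t • e)) t := by
  have : AnalyticAt ℂ (fun t : ℂ => q + t • e) t := by fun_prop
  exact hh.comp_of_eq this rfl

theorem AnalyticAt.fderiv_apply [CompleteSpace F] {h : E → F} {q : E} (hh : AnalyticAt ℂ h q)
    (e : E) : AnalyticAt ℂ (fun z => fderiv ℂ h z e) q :=
  ((ContinuousLinearMap.apply ℂ F e).analyticAt _).comp hh.fderiv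

/-- The `j`-th derivative of `h` in the direction `e`. -/
noncomputable def dirDeriv (e : E) (h : E → ℂ) : ℕ → E → ℂ
  | 0 => h
  | j + 1 => fun z => fderiv ℂ (dirDeriv e h j) z e

theorem analyticAt_dirDeriv {h : E → ℂ} {q : E} (hh : AnalyticAt ℂ h q) (e : E) (j : ℕ) :
    AnalyticAt ℂ (dirDeriv e h j) q := by
  induction j with
  | zero => exact hh
  | succ j ih => exact ih.fderiv_apply e

theorem AnalyticAt.iteratedDeriv_line_eq {h : E → ℂ} {q : E} (hh : AnalyticAt ℂ h q) (e : E)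
    (j : ℕ) : iteratedDeriv j (fun t : ℂ => h (q + t • e)) =ᶠ[𝓝 0]
      fun t => dirDeriv e h j (q + t • e) := by
  induction j with
  | zero => simp [dirDeriv]
  | succ j ih =>
    rw [iteratedDeriv_succ]
    refine ih.deriv.trans ?_
    have hc : ContinuousAt (fun t : ℂ => q + t • e) 0 := by fun_prop
    have h1 : ∀ᶠ t in 𝓝 (0 : ℂ), AnalyticAt ℂ (dirDeriv e h j) (q + t • e) :=
      hc.eventually (by simpa using (analyticAt_dirDeriv hh e j).eventually_analyticAt)
    filter_upwards [h1] with t ht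
    have h2 : HasDerivAt (fun t : ℂ => q + t • e) e t := by
      simpa using ((hasDerivAt_id t).smul_const e).const_add q
    exact (ht.differentiableAt.hasFDerivAt.comp_hasDerivAt t h2).deriv

theorem AnalyticAt.line_eventually_eq_zero_iff {h : E → ℂ} {q : E} (hh : AnalyticAt ℂ h q) (e : E) :
    (∀ᶠ t in 𝓝 (0 : ℂ), h (q + t • e) = 0) ↔ ∀ j, dirDeriv e h j q = 0 := by
  have hval : ∀ j, iteratedDeriv j (fun t : ℂ => h (q + t • e)) 0 = dirDeriv e h j q :=
    fun j => by simpa using (hh.iteratedDeriv_line_eq e j).eq_of_nhds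
  have hφ : AnalyticAt ℂ (fun t : ℂ => h (q + t • e)) 0 := AnalyticAt.comp_line (by simpa)
  rw [← analyticOrderAt_eq_top, ENat.eq_top_iff_forall_ge]
  simp only [natCast_le_analyticOrderAt_iff_iteratedDeriv_eq_zero hφ, hval]
  exact ⟨fun H j => H (j + 1) j (Nat.lt_succ_self j), fun H n i _ => H i⟩

/-- If `h` is analytic, vanishes at `p` and does not vanish identically near `p`, then some
function `k` vanishing on the zero set of `h` is a submersion at a zero `q` of `h` near `p`. -/
theorem AnalyticAt.exists_defining_function {h : E → ℂ} {p : E} (hh : AnalyticAt ℂ h p)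
    (hp : h p = 0) (hne : ¬ ∀ᶠ z in 𝓝 p, h z = 0) {W : Set E} (hW : W ∈ 𝓝 p) :
    ∃ (e : E) (q : E) (k : E → ℂ), q ∈ W ∧ h q = 0 ∧ AnalyticAt ℂ h q ∧ AnalyticAt ℂ k q ∧
      (∀ᶠ z in 𝓝 q, h z = 0 → k z = 0) ∧ fderiv ℂ k q e ≠ 0 ∧
      ¬ ∀ᶠ t in 𝓝 (0 : ℂ), h (q + t • e) = 0 := by
  obtain ⟨r, hr, hrW⟩ := Metric.mem_nhds_iff.1 (inter_mem hW hh.eventually_analyticAt)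
  -- If `h` vanished near `p` along every line, the identity theorem on each line's convex slice of
  -- the ball would make it vanish on the ball.
  obtain ⟨e, he⟩ : ∃ e, ¬ ∀ᶠ t in 𝓝 (0 : ℂ), h (p + t • e) = 0 := by
    by_contra! H
    refine hne ?_
    filter_upwards [ball_mem_nhds p hr] with z hz
    let S : Set ℂ := (fun t : ℂ => p + t • (z - p)) ⁻¹' ball p r
    have hS : Convex ℝ S := by
      have h1 : S = (LinearMap.toSpanSingleton ℂ E (z - p)).restrictScalars ℝ ⁻¹' ball 0 r := by
        ext t; simp [S, dist_eq_norm]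
      rw [h1]
      exact (convex_ball _ _).linear_preimage _
    have hA : AnalyticOnNhd ℂ (fun t : ℂ => h (p + t • (z - p))) S := fun t ht =>
      AnalyticAt.comp_line (hrW ht).2
    have := hA.eqOn_zero_of_preconnected_of_eventuallyEq_zero hS.isPreconnected
      (show (0 : ℂ) ∈ S by simpa [S] using hr) (H (z - p)) (show (1 : ℂ) ∈ S by simpa [S] using hz)
    simpa using this
  -- Take `j` least. Then the derivative of order `j - 1` vanishes at every zero of `h` in the ball,
  -- while its own `e`-derivative is nonzero at `q`: it is the required `k`.
  have hex : ∃ j, ∃ q ∈ ball p r, h q = 0 ∧ dirDeriv e h j q ≠ 0 := by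
    rw [hh.line_eventually_eq_zero_iff] at he
    push Not at he
    obtain ⟨j, hj⟩ := he
    exact ⟨j, p, mem_ball_self hr, hp, hj⟩
  classical
  obtain ⟨q, hq, hq0, hqj⟩ := Nat.find_spec hex
  have hmin : ∀ m < Nat.find hex, ∀ z ∈ ball p r, h z = 0 → dirDeriv e h m z = 0 := by
    intro m hm z hz hz0
    by_contra hcon
    exact Nat.find_min hex hm ⟨z, hz, hz0, hcon⟩
  generalize Nat.find hex = j at hqj hmin
  have hhq : AnalyticAt ℂ h q := (hrW hq).2
  cases j with
  | zero => exact absurd hq0 hqj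
  | succ m =>
    refine ⟨e, q, dirDeriv e h m, (hrW hq).1, hq0, hhq, analyticAt_dirDeriv hhq e m, ?_, hqj, ?_⟩
    · filter_upwards [isOpen_ball.mem_nhds hq] with z hz using hmin m (Nat.lt_succ_self m) z hz
    · rw [hhq.line_eventually_eq_zero_iff]
      exact fun H => hqj (H _)

/-- A weak form of Hurwitz's theorem: zeros of `h` along a line persist on parallel lines. -/
theorem AnalyticAt.eventually_exists_zero_on_line {h : E → ℂ} {q e : E} (hh : AnalyticAt ℂ h q)
    (hq : h q = 0) (hne : ¬ ∀ᶠ t in 𝓝 (0 : ℂ), h (q + t • e) = 0) {r : ℝ} (hr : 0 < r) :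
    ∀ᶠ z in 𝓝 q, ∃ t : ℂ, ‖t‖ ≤ r ∧ h (z + t • e) = 0 := by
  have hφ : AnalyticAt ℂ (fun t : ℂ => h (q + t • e)) 0 := AnalyticAt.comp_line (by simpa)
  have h1 := hφ.eventually_eq_zero_or_eventually_ne_zero.resolve_left hne
  rw [eventually_nhdsWithin_iff] at h1
  have hc : ContinuousAt (fun t : ℂ => q + t • e) 0 := by fun_prop
  have h2 : ∀ᶠ t in 𝓝 (0 : ℂ), AnalyticAt ℂ h (q + t • e) :=
    hc.eventually (by simpa using hh.eventually_analyticAt)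
  obtain ⟨ρ₀, hρ₀, hball⟩ := Metric.nhds_basis_closedBall.eventually_iff.1 (h1.and h2)
  let ρ := min ρ₀ r
  have hρ : 0 < ρ := lt_min hρ₀ hr
  have hsub : closedBall (0 : ℂ) ρ ⊆ closedBall 0 ρ₀ := closedBall_subset_closedBall (min_le_left _ _)
  have hcs : ContinuousOn (fun t : ℂ => ‖h (q + t • e)‖) (sphere 0 ρ) := fun t ht =>
    (AnalyticAt.comp_line
      (hball (hsub (sphere_subset_closedBall ht))).2).continuousAt.continuousWithinAt.norm
  obtain ⟨ε, hε, hεs⟩ := (isCompact_sphere (0 : ℂ) ρ).exists_forall_le' hcs (a := 0) (by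
    intro t ht
    refine norm_pos_iff.2 ((hball (hsub (sphere_subset_closedBall ht))).1 ?_)
    rintro rfl
    simp [hρ.ne] at ht)
  -- With error `ε / 4`, the restriction `ζ` to the parallel line satisfies `‖ζ t - ζ 0‖ ≥ ε / 2` on
  -- the circle and `‖ζ 0‖ < ε / 4`. The quantitative open mapping theorem covers the disc of radius
  -- `ε / 4` about `ζ 0`, which contains `0`.
  have hev : ∀ᶠ z in 𝓝 q, ∀ t ∈ closedBall (0 : ℂ) ρ,
      AnalyticAt ℂ h (z + t • e) ∧ ‖h (z + t • e) - h (q + t • e)‖ < ε / 4 := by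
    refine (isCompact_closedBall (0 : ℂ) ρ).eventually_forall_of_forall_eventually fun t ht => ?_
    have ha := (hball (hsub ht)).2
    have hc1 : ContinuousAt (fun y : E × ℂ => y.1 + y.2 • e) (q, t) := by fun_prop
    have hc2 : ContinuousAt (fun y : E × ℂ => q + y.2 • e) (q, t) := by fun_prop
    have hc3 : ContinuousAt (fun y : E × ℂ => ‖h (y.1 + y.2 • e) - h (q + y.2 • e)‖) (q, t) :=
      ((ContinuousAt.comp_of_eq ha.continuousAt hc1 rfl).sub
        (ContinuousAt.comp_of_eq ha.continuousAt hc2 rfl)).norm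
    exact (hc1.eventually ha.eventually_analyticAt).and
      (hc3.eventually (gt_mem_nhds (by simpa using div_pos hε four_pos)))
  filter_upwards [hev] with z hz
  let ζ : ℂ → ℂ := fun t => h (z + t • e)
  have hζ : AnalyticOnNhd ℂ ζ (closedBall 0 ρ) := fun t ht => AnalyticAt.comp_line (hz t ht).1
  have h0 : ‖ζ 0‖ < ε / 4 := by
    have := (hz 0 (mem_closedBall_self hρ.le)).2
    simpa [ζ, hq] using this
  have hsph : ∀ t ∈ sphere (0 : ℂ) ρ, ε / 2 ≤ ‖ζ t - ζ 0‖ := by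
    intro t ht
    have h3 := (hz t (sphere_subset_closedBall ht)).2
    have h4 := hεs t ht
    have h5 : ‖h (q + t • e)‖ ≤ ‖ζ t - ζ 0‖ + ‖ζ 0‖ + ‖ζ t - h (q + t • e)‖ := by
      calc ‖h (q + t • e)‖ = ‖(ζ t - ζ 0) + ζ 0 - (ζ t - h (q + t • e))‖ := by congr 1; ring
        _ ≤ _ := (norm_sub_le _ _).trans (by gcongr; exact norm_add_le _ _)
    have h3' : ‖ζ t - h (q + t • e)‖ < ε / 4 := h3
    linarith
  have hfreq : ∃ᶠ t in 𝓝 (0 : ℂ), ζ t ≠ ζ 0 := by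
    intro hcon
    simp only [not_not] at hcon
    have h3 := hζ.eqOn_of_preconnected_of_eventuallyEq (g := fun _ => ζ 0) analyticOnNhd_const
      (convex_closedBall (0 : ℂ) ρ).isPreconnected (mem_closedBall_self hρ.le) hcon
    have h4 : ((ρ : ℝ) : ℂ) ∈ sphere (0 : ℂ) ρ := by simp [abs_of_pos hρ]
    have h5 := hsph _ h4
    rw [h3 (sphere_subset_closedBall h4)] at h5
    simp at h5
    linarith
  have hdiff : DiffContOnCl ℂ ζ (ball 0 ρ) := by
    refine DifferentiableOn.diffContOnCl ?_
    rw [closure_ball _ hρ.ne']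
    exact hζ.differentiableOn
  obtain ⟨t, ht, ht0⟩ := hdiff.ball_subset_image_closedBall hρ hsph hfreq
    (show (0 : ℂ) ∈ ball (ζ 0) (ε / 2 / 2) by
      rw [mem_ball, dist_zero_left]; linarith)
  exact ⟨t, (by simpa using ht : ‖t‖ ≤ ρ).trans (min_le_right _ _), ht0⟩

end InjectiveHolomorphic

/-! ### Level sets and the one-variable case -/

section LevelSets

open Metric Set Filter

universe u v

variable {E : Type u} {F : Type v} [NormedAddCommGroup E] [NormedSpace ℂ E]
  [NormedAddCommGroup F] [NormedSpace ℂ F]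

theorem ContinuousLinearMap.sub_smul_mem_ker {E : Type*} [NormedAddCommGroup E] [NormedSpace ℂ E]
    {ℓ : E →L[ℂ] ℂ} {e : E} (he : ℓ e = 1) (v : E) :
    (ContinuousLinearMap.id ℂ E - ℓ.smulRight e) v ∈ LinearMap.ker (ℓ : E →ₗ[ℂ] ℂ) := by
  simp [he]

/-- Splitting of a space along a continuous linear form. -/
noncomputable def ContinuousLinearMap.splitKer (ℓ : E →L[ℂ] ℂ) {e : E} (he : ℓ e = 1) :
    E ≃L[ℂ] ℂ × LinearMap.ker (ℓ : E →ₗ[ℂ] ℂ) :=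
  ContinuousLinearEquiv.equivOfInverse
    (ℓ.prod ((ContinuousLinearMap.id ℂ E - ℓ.smulRight e).codRestrict _
      (ContinuousLinearMap.sub_smul_mem_ker he)))
    (((ContinuousLinearMap.fst ℂ ℂ _).smulRight e) +
      (Submodule.subtypeL _).comp (ContinuousLinearMap.snd ℂ ℂ _))
    (fun v => by simp)
    (fun ⟨c, v, hv⟩ => by
      have hv' : ℓ v = 0 := hv
      ext <;> simp [he, hv'])

theorem ContinuousLinearMap.splitKer_symm_zero (ℓ : E →L[ℂ] ℂ) {e : E} (he : ℓ e = 1)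
    (v : LinearMap.ker (ℓ : E →ₗ[ℂ] ℂ)) : (ℓ.splitKer he).symm (0, v) = v := by
  simp [splitKer]

theorem exists_apply_eq_one {ℓ : E →L[ℂ] ℂ} (hℓ : ℓ ≠ 0) : ∃ e, ℓ e = 1 := by
  obtain ⟨v, hv⟩ : ∃ v, ℓ v ≠ 0 := by
    by_contra! h
    exact hℓ (ContinuousLinearMap.ext h)
  exact ⟨(ℓ v)⁻¹ • v, by simp [hv]⟩

/-- Local analytic parametrization of the level set of a submersion to `ℂ`. -/
theorem AnalyticAt.exists_levelSet_parametrization [CompleteSpace E] {g : E → ℂ} {p : E}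
    (hg : AnalyticAt ℂ g p) {ℓ : E →L[ℂ] ℂ} (hℓ : fderiv ℂ g p = ℓ) (hne : ℓ ≠ 0) :
    ∃ ψ : LinearMap.ker (ℓ : E →ₗ[ℂ] ℂ) → E, AnalyticAt ℂ ψ 0 ∧ ψ 0 = p ∧
      HasFDerivAt ψ (Submodule.subtypeL _) 0 ∧ (∀ᶠ x in 𝓝 0, g (ψ x) = g p) ∧
      ∃ s ∈ 𝓝 (0 : LinearMap.ker (ℓ : E →ₗ[ℂ] ℂ)), InjOn ψ s := by
  obtain ⟨e, he⟩ := exists_apply_eq_one hne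
  let K := LinearMap.ker (ℓ : E →ₗ[ℂ] ℂ)
  have hK : IsClosed (K : Set E) := ContinuousLinearMap.isClosed_ker ℓ
  have : CompleteSpace K := hK.completeSpace_coe
  let π : E →L[ℂ] K := (ContinuousLinearMap.snd ℂ ℂ K).comp (ℓ.splitKer he : E →L[ℂ] ℂ × K)
  -- Straightening map: its derivative at `p` is the splitting isomorphism, and the parametrization
  -- is the slice of its local inverse with first coordinate `g p`.
  let Φ : E → ℂ × K := fun z => (g z, π (z - p))
  have hΦ : AnalyticAt ℂ Φ p := hg.prod ((π.analyticAt _).comp (by fun_prop))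
  have hΦ' : HasFDerivAt Φ ((ℓ.splitKer he : E ≃L[ℂ] ℂ × K) : E →L[ℂ] ℂ × K) p := by
    have h1 : HasFDerivAt g ℓ p := hℓ ▸ hg.differentiableAt.hasFDerivAt
    have h2 : HasFDerivAt (fun z => π (z - p)) π p := by
      exact π.hasFDerivAt.comp p ((hasFDerivAt_id p).sub_const p)
    exact h1.prodMk h2
  have hcd : ContDiffAt ℂ ω Φ p := hΦ.contDiffAt
  have hω : (ω : WithTop ℕ∞) ≠ 0 := by simp
  have hs : HasStrictFDerivAt Φ ((ℓ.splitKer he : E ≃L[ℂ] ℂ × K) : E →L[ℂ] ℂ × K) p :=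
    hcd.hasStrictFDerivAt' hΦ' hω
  let Ψ := hcd.localInverse hΦ' hω
  have hΦp : Φ p = (g p, 0) := by simp [Φ]
  have hΨ : ContDiffAt ℂ ω Ψ (g p, 0) := hΦp ▸ hcd.to_localInverse hΦ' hω
  have hΨp : Ψ (g p, 0) = p := hΦp ▸ hcd.localInverse_apply_image hΦ' hω
  have hΨ' : HasFDerivAt Ψ ((ℓ.splitKer he).symm : ℂ × K →L[ℂ] E) (g p, 0) :=
    hΦp ▸ hs.to_localInverse.hasFDerivAt
  have hinc : HasFDerivAt (fun x : K => (g p, x)) (ContinuousLinearMap.inr ℂ ℂ K) 0 :=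
    hasFDerivAt_prodMk_right (g p) 0
  have hr : ∀ᶠ y in 𝓝 (g p, (0 : K)), Φ (Ψ y) = y := hΦp ▸ hs.eventually_right_inverse
  have hc : ContinuousAt (fun x : K => (g p, x)) 0 := by fun_prop
  have hr' : ∀ᶠ x in 𝓝 (0 : K), Φ (Ψ (g p, x)) = (g p, x) := hc.eventually hr
  refine ⟨fun x => Ψ (g p, x), ?_, hΨp, ?_, ?_, _, hr', ?_⟩
  · have := (hΨ.comp (0 : K) (show ContDiffAt ℂ ω (fun x : K => (g p, x)) 0 by fun_prop))
    exact this.analyticAt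
  · have h1 := HasFDerivAt.comp (0 : K) hΨ' hinc
    have h2 : ((ℓ.splitKer he).symm : ℂ × K →L[ℂ] E).comp (ContinuousLinearMap.inr ℂ ℂ K) =
        Submodule.subtypeL K := by
      ext v
      simpa using ContinuousLinearMap.splitKer_symm_zero ℓ he v
    rw [h2] at h1
    exact h1
  · exact hr'.mono fun x hx => congrArg Prod.fst hx
  · intro x hx y hy hxy
    have h1 : Φ (Ψ (g p, x)) = (g p, x) := hx
    have h2 : Φ (Ψ (g p, y)) = (g p, y) := hy
    have hxy' : Ψ (g p, x) = Ψ (g p, y) := hxy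
    rw [hxy', h2] at h1
    exact (congrArg Prod.snd h1).symm

/-- If `φ - φ 0` has order `n`, it equals a constant times `w ^ n` in a local coordinate `w`.
Multiplying `w` by a primitive `n`-th root of unity preserves the value, so injectivity forces `n =
1`, which is incompatible with a zero derivative. -/
theorem AnalyticAt.deriv_ne_zero_of_injOn {φ : ℂ → ℂ} (hφ : AnalyticAt ℂ φ 0) {s : Set ℂ}
    (hs : s ∈ 𝓝 0) (hinj : InjOn φ s) : deriv φ 0 ≠ 0 := by
  intro hd
  have hφ₁ : AnalyticAt ℂ (fun z => φ z - φ 0) 0 := hφ.sub analyticAt_const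
  have hnc : ¬ ∀ᶠ z in 𝓝 (0 : ℂ), φ z - φ 0 = 0 := by
    intro hcon
    have h1 : ∀ᶠ z in 𝓝[≠] (0 : ℂ), z = 0 := by
      rw [eventually_nhdsWithin_iff]
      filter_upwards [hcon, hs] with z hz hzs _
      exact hinj hzs (mem_of_mem_nhds hs) (sub_eq_zero.1 hz)
    obtain ⟨z, hz, hz0⟩ := (h1.and self_mem_nhdsWithin).exists
    exact hz0 hz
  obtain ⟨n, g, hg, hg0, hφg⟩ := hφ₁.exists_eventuallyEq_pow_smul_nonzero_iff.2 hnc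
  simp only [sub_zero, smul_eq_mul] at hφg
  have hn0 : n ≠ 0 := by
    rintro rfl
    have := hφg.self_of_nhds
    simp at this
    exact hg0 this.symm
  have hn1 : n ≠ 1 := by
    rintro rfl
    have h1 : HasDerivAt (fun z => z ^ 1 * g z) (g 0) 0 := by
      simpa using (hasDerivAt_id' (0 : ℂ)).fun_mul hg.differentiableAt.hasDerivAt
    have h2 : HasDerivAt (fun z => φ z - φ 0) (g 0) 0 := h1.congr_of_eventuallyEq hφg
    have h3 : HasDerivAt (fun z => φ z - φ 0) 0 0 := by
      simpa [hd] using hφ.differentiableAt.hasDerivAt.sub_const (φ 0)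
    exact hg0 (h2.unique h3)
  -- Dividing by `g 0` puts the base near `1`, where the principal root is analytic, and gives `w' 0
  -- = 1`.
  let w : ℂ → ℂ := fun z => z * (g z / g 0) ^ ((n : ℂ)⁻¹)
  have hroot : AnalyticAt ℂ (fun z => (g z / g 0) ^ ((n : ℂ)⁻¹)) 0 :=
    (hg.div_const).cpow analyticAt_const (by simp [hg0])
  have hw : AnalyticAt ℂ w 0 := analyticAt_id.mul hroot
  have hwn : ∀ z, w z ^ n = z ^ n * g z / g 0 := by
    intro z
    simp only [w, mul_pow, Complex.cpow_nat_inv_pow _ hn0]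
    ring
  have hw' : HasDerivAt w 1 0 := by
    simpa [hg0] using (hasDerivAt_id' (0 : ℂ)).fun_mul hroot.differentiableAt.hasDerivAt
  have hws : HasStrictDerivAt w 1 0 := by
    have := hw.hasStrictDerivAt
    rwa [hw'.deriv] at this
  have hw0 : w 0 = 0 := by simp [w]
  have hmap : map w (𝓝 0) = 𝓝 0 := by
    simpa [hw0] using hws.map_nhds_eq one_ne_zero
  let T : Set ℂ := w '' {z | φ z - φ 0 = z ^ n * g z ∧ z ∈ s}
  have hT : T ∈ 𝓝 (0 : ℂ) := by
    rw [← hmap]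
    exact image_mem_map (hφg.and hs)
  let ζ : ℂ := Complex.exp (2 * Real.pi * Complex.I / n)
  have hζ : IsPrimitiveRoot ζ n := Complex.isPrimitiveRoot_exp n hn0
  have hT' : ∀ᶠ y in 𝓝 (0 : ℂ), ζ * y ∈ T :=
    (show ContinuousAt (fun y : ℂ => ζ * y) 0 by fun_prop).eventually (by simpa using hT)
  have hev : ∀ᶠ y in 𝓝[≠] (0 : ℂ), y ∈ T ∧ ζ * y ∈ T := nhdsWithin_le_nhds (inter_mem hT hT')
  obtain ⟨y, ⟨⟨a, ⟨ha, has⟩, hay⟩, ⟨b, ⟨hb, hbs⟩, hby⟩⟩, hy0⟩ :=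
    (hev.and self_mem_nhdsWithin).exists
  have h1 : a ^ n * g a = b ^ n * g b := by
    have h2 : w a ^ n = w b ^ n := by rw [hay, hby, mul_pow, hζ.pow_eq_one, one_mul]
    rw [hwn, hwn] at h2
    field_simp at h2
    exact h2
  have hab : a = b := hinj has hbs (by rw [← ha, ← hb] at h1; exact sub_left_injective h1)
  rw [hab, hby] at hay
  have h3 : ζ = 1 := mul_right_cancel₀ hy0 (hay.trans (one_mul y).symm)
  rw [h3] at hζ
  exact hn1 (hζ.unique IsPrimitiveRoot.one)

theorem AnalyticAt.eventually_eq_of_fderiv_eq_zero [CompleteSpace F] {G : E → F} {p : E}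
    (hG : AnalyticAt ℂ G p) (h0 : ∀ᶠ x in 𝓝 p, fderiv ℂ G x = 0) : ∀ᶠ x in 𝓝 p, G x = G p := by
  obtain ⟨r, hr, hball⟩ := Metric.eventually_nhds_iff_ball.1 (h0.and hG.eventually_analyticAt)
  filter_upwards [ball_mem_nhds p hr] with x hx
  exact isOpen_ball.is_const_of_fderiv_eq_zero (𝕜 := ℂ) (convex_ball p r).isPreconnected
    (fun y hy => (hball y hy).2.differentiableAt.differentiableWithinAt)
    (fun y hy => (hball y hy).1) hx (mem_ball_self hr)

theorem not_injOn_of_eventually_eq {α : Type*} [Nontrivial E] {G : E → α} {p : E}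
    (h : ∀ᶠ x in 𝓝 p, G x = G p)    {s : Set E} (hs : s ∈ 𝓝 p) : ¬ InjOn G s := by
  intro hinj
  have h1 : ∀ᶠ x in 𝓝[≠] p, x = p := nhdsWithin_le_nhds (by
    filter_upwards [h, hs] with x hx hxs using hinj hxs (mem_of_mem_nhds hs) hx)
  have : (𝓝[≠] p).NeBot := Module.punctured_nhds_neBot ℂ E p
  obtain ⟨x, hx, hx0⟩ := (h1.and self_mem_nhdsWithin).exists
  exact hx0 hx

end LevelSets

/-! ### Osgood's theorem -/

section InjectiveFDeriv

open Metric Set Filter Module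

universe u v

variable {E : Type u} {F : Type v} [NormedAddCommGroup E] [NormedSpace ℂ E]
  [FiniteDimensional ℂ E] [NormedAddCommGroup F] [NormedSpace ℂ F] [FiniteDimensional ℂ F]

theorem finrank_ker_add_one {ℓ : E →L[ℂ] ℂ} (hℓ : ℓ ≠ 0) :
    finrank ℂ (LinearMap.ker (ℓ : E →ₗ[ℂ] ℂ)) + 1 = finrank ℂ E := by
  obtain ⟨e, he⟩ := exists_apply_eq_one hℓ
  rw [(ℓ.splitKer he).toLinearEquiv.finrank_eq, finrank_prod, finrank_self, add_comm]

theorem AnalyticAt.injective_fderiv_of_finrank_eq_one (hE : finrank ℂ E = 1) (hF : finrank ℂ F = 1)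
    {f : E → F} {p : E} (hf : AnalyticAt ℂ f p) {s : Set E} (hs : s ∈ 𝓝 p) (hinj : InjOn f s) :
    Function.Injective (fderiv ℂ f p) := by
  obtain ⟨e, he0, he⟩ := finrank_eq_one_iff'.1 hE
  let L : F ≃L[ℂ] ℂ := ContinuousLinearEquiv.ofFinrankEq (by simp [hF])
  have hc : ContinuousAt (fun t : ℂ => p + t • e) 0 := by fun_prop
  have hφ : AnalyticAt ℂ (fun t : ℂ => L (f (p + t • e))) 0 :=
    ((L : F →L[ℂ] ℂ).analyticAt _).comp
      (AnalyticAt.comp_line (h := f) (q := p) (e := e) (t := 0) (by simpa))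
  have hd := hφ.deriv_ne_zero_of_injOn (s := (fun t : ℂ => p + t • e) ⁻¹' s)
    (hc.preimage_mem_nhds (by simpa)) (by
      intro t ht t' ht' h
      have := hinj ht ht' (L.injective h)
      exact smul_left_injective ℂ he0 (add_left_cancel this))
  have h1 : HasDerivAt (fun t : ℂ => p + t • e) e 0 := by
    simpa using ((hasDerivAt_id (0 : ℂ)).smul_const e).const_add p
  have h2 : HasDerivAt (fun t : ℂ => L (f (p + t • e))) (L (fderiv ℂ f p e)) 0 := by
    have h3 : HasFDerivAt f (fderiv ℂ f p) (p + (0 : ℂ) • e) := by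
      simpa using hf.differentiableAt.hasFDerivAt
    exact (L : F →L[ℂ] ℂ).hasFDerivAt.comp_hasDerivAt 0 (h3.comp_hasDerivAt 0 h1)
  rw [h2.deriv] at hd
  rw [injective_iff_map_eq_zero]
  intro v hv
  obtain ⟨c, rfl⟩ := he v
  rw [map_smul] at hv
  rcases smul_eq_zero.1 hv with h | h
  · simp [h]
  · exact absurd (by rw [h, map_zero]) hd

/-- Inductive step: an injective analytic map with nonzero derivative is reduced to an injective
analytic map between hyperplanes. -/
theorem AnalyticAt.injective_fderiv_of_fderiv_ne_zero {n : ℕ}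
    (ih : ∀ (E : Type u) (F : Type v) [NormedAddCommGroup E] [NormedSpace ℂ E]
      [FiniteDimensional ℂ E] [NormedAddCommGroup F] [NormedSpace ℂ F] [FiniteDimensional ℂ F]
      (_ : finrank ℂ E = n) (_ : finrank ℂ F = n) (f : E → F) (p : E) (_ : AnalyticAt ℂ f p)
      (s : Set E) (_ : s ∈ 𝓝 p) (_ : InjOn f s), Function.Injective (fderiv ℂ f p))
    (hE : finrank ℂ E = n + 1) (hF : finrank ℂ F = n + 1)
    {f : E → F} {p : E} (hf : AnalyticAt ℂ f p) {s : Set E} (hs : s ∈ 𝓝 p) (hinj : InjOn f s)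
    (hne : fderiv ℂ f p ≠ 0) : Function.Injective (fderiv ℂ f p) := by
  obtain ⟨v, hv⟩ : ∃ v, fderiv ℂ f p v ≠ 0 := by
    by_contra! h
    exact hne (ContinuousLinearMap.ext h)
  obtain ⟨ℓ, hℓv⟩ := SeparatingDual.exists_ne_zero (R := ℂ) hv
  have hℓ : ℓ ≠ 0 := by rintro rfl; simp at hℓv
  let ℓ' : E →L[ℂ] ℂ := ℓ.comp (fderiv ℂ f p)
  have hℓ' : ℓ' ≠ 0 := by
    intro h
    exact hℓv (congrArg (fun T : E →L[ℂ] ℂ => T v) h)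
  have hg : AnalyticAt ℂ (fun z => ℓ (f z)) p := (ℓ.analyticAt _).comp hf
  have hg' : fderiv ℂ (fun z => ℓ (f z)) p = ℓ' :=
    (ℓ.hasFDerivAt.comp p hf.differentiableAt.hasFDerivAt).fderiv
  obtain ⟨ψ, hψ, hψ0, hψ', hψℓ, t, ht, hψt⟩ := hg.exists_levelSet_parametrization hg' hℓ'
  let K := LinearMap.ker (ℓ' : E →ₗ[ℂ] ℂ)
  let K' := LinearMap.ker (ℓ : F →ₗ[ℂ] ℂ)
  obtain ⟨e, he⟩ := exists_apply_eq_one hℓ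
  -- On the level set of `ℓ ∘ f`, the difference `f - f p` already lies in `ker ℓ`, where `π` is the
  -- identity, so injectivity survives.
  let π : F →L[ℂ] K' := (ContinuousLinearMap.snd ℂ ℂ K').comp (ℓ.splitKer he : F →L[ℂ] ℂ × K')
  have hπ : ∀ y, ℓ y = 0 → (π y : F) = y := by
    intro y hy
    have h1 : (π y : F) = y - ℓ y • e := rfl
    rw [h1, hy]; simp
  have hfψ : AnalyticAt ℂ (fun x => f (ψ x)) 0 := AnalyticAt.comp_of_eq hf hψ hψ0
  have han : AnalyticAt ℂ (fun x => π (f (ψ x) - f p)) 0 :=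
    (π.analyticAt _).comp (hfψ.sub analyticAt_const)
  have hder : HasFDerivAt (fun x => π (f (ψ x) - f p))
      (π.comp ((fderiv ℂ f p).comp (Submodule.subtypeL K))) 0 := by
    have h1 : HasFDerivAt f (fderiv ℂ f p) (ψ 0) := hψ0 ▸ hf.differentiableAt.hasFDerivAt
    exact π.hasFDerivAt.comp 0 ((h1.comp 0 hψ').sub_const (f p))
  have hsψ : ∀ᶠ x in 𝓝 (0 : K), ψ x ∈ s :=
    hψ.continuousAt.eventually (by rw [hψ0]; exact hs)
  have hinj' := ih K K' (Nat.succ_injective ((finrank_ker_add_one hℓ').trans hE))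
    (Nat.succ_injective ((finrank_ker_add_one hℓ).trans hF)) _ 0 han _ (inter_mem (inter_mem ht hsψ) hψℓ) (by
      rintro x ⟨⟨hxt, hxs⟩, hx⟩ y ⟨⟨hyt, hys⟩, hy⟩ hxy
      have hx' : ℓ (f (ψ x) - f p) = 0 := by rw [map_sub, sub_eq_zero]; exact hx
      have hy' : ℓ (f (ψ y) - f p) = 0 := by rw [map_sub, sub_eq_zero]; exact hy
      have h1 := congrArg (Subtype.val) hxy
      simp only [hπ _ hx', hπ _ hy'] at h1
      exact hψt hxt hyt (hinj hxs hys (sub_left_injective h1)))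
  rw [hder.fderiv] at hinj'
  rw [injective_iff_map_eq_zero]
  intro u hu
  -- A vector killed by `f'` is tangent to the level set, so injectivity of the restricted
  -- derivative is enough.
  have huK : u ∈ K := show ℓ (fderiv ℂ f p u) = 0 by rw [hu, map_zero]
  have h1 : (⟨u, huK⟩ : K) = 0 := hinj' (by simp [hu])
  exact congrArg Subtype.val h1

/-- Strict differentiability makes `k (y + t e) - k y` equal to `t k'(q) e` up to half its size,
uniformly for `y` near `q`. Hence `k` is injective on short segments in direction `e`. -/
theorem AnalyticAt.eventually_eq_zero_of_line_eq {E : Type*} [NormedAddCommGroup E]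
    [NormedSpace ℂ E] {k : E → ℂ} {q e : E}
    (hk : AnalyticAt ℂ k q) (he : fderiv ℂ k q e ≠ 0) :
    ∀ᶠ y in 𝓝 (q, (0 : ℂ)), k (y.1 + y.2 • e) = k y.1 → y.2 = 0 := by
  have hs := hk.hasStrictFDerivAt
  have hpos : 0 < ‖fderiv ℂ k q e‖ := norm_pos_iff.2 he
  have he0 : e ≠ 0 := by rintro rfl; simp at he
  have hepos : 0 < ‖e‖ := norm_pos_iff.2 he0
  have h1 := hs.isLittleO.def (c := ‖fderiv ℂ k q e‖ / (2 * ‖e‖)) (by positivity)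
  have hc : ContinuousAt (fun y : E × ℂ => (y.1 + y.2 • e, y.1)) (q, 0) := by fun_prop
  have h2 := hc.eventually (by simpa using h1)
  filter_upwards [h2] with y hy hky
  by_contra hy0
  have hypos : 0 < ‖y.2‖ := norm_pos_iff.2 hy0
  rw [← map_sub] at hy
  simp only [hky, sub_self, add_sub_cancel_left, map_smul, zero_sub, norm_neg, norm_smul] at hy
  have h3 : ‖fderiv ℂ k q e‖ / (2 * ‖e‖) * (‖y.2‖ * ‖e‖) = ‖y.2‖ * ‖fderiv ℂ k q e‖ / 2 := by
    field_simp
  rw [h3] at hy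
  have : 0 < ‖y.2‖ * ‖fderiv ℂ k q e‖ := by positivity
  linarith

/-- **Osgood's theorem**: an injective holomorphic map between spaces of equal dimension is
immersive. -/
theorem AnalyticAt.injective_fderiv_of_injOn (n : ℕ) : ∀ (E : Type u) (F : Type v)
    [NormedAddCommGroup E] [NormedSpace ℂ E] [FiniteDimensional ℂ E]
    [NormedAddCommGroup F] [NormedSpace ℂ F] [FiniteDimensional ℂ F]
    (_ : finrank ℂ E = n) (_ : finrank ℂ F = n) (f : E → F) (p : E) (_ : AnalyticAt ℂ f p)
    (s : Set E) (_ : s ∈ 𝓝 p) (_ : InjOn f s), Function.Injective (fderiv ℂ f p) := by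
  induction n with
  | zero =>
    intro E F _ _ _ _ _ _ hE _ f p _ s _ _
    have := finrank_zero_iff.1 hE
    exact Function.injective_of_subsingleton _
  | succ n ih =>
    intro E F _ _ _ _ _ _ hE hF f p hf s hs hinj
    rcases Nat.eq_zero_or_pos n with rfl | hn
    · exact hf.injective_fderiv_of_finrank_eq_one hE hF hs hinj
    by_contra hnot
    have : Nontrivial E := finrank_pos_iff.1 (by omega : 0 < finrank ℂ E)
    -- By the inductive reduction, a derivative that is not injective must be zero.
    have stepA : ∀ z, AnalyticAt ℂ f z → s ∈ 𝓝 z → ¬ Function.Injective (fderiv ℂ f z) →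
        fderiv ℂ f z = 0 := by
      intro z hz hsz hzi
      by_contra hne
      exact hzi (hz.injective_fderiv_of_fderiv_ne_zero ih hE hF hsz hinj hne)
    let L : F ≃L[ℂ] E := ContinuousLinearEquiv.ofFinrankEq (by rw [hE, hF])
    let A : E → E →L[ℂ] E := fun z => (L : F →L[ℂ] E).comp (fderiv ℂ f z)
    let h : E → ℂ := fun z => (A z).det
    have hA : ∀ z, h z = 0 ↔ ¬ Function.Injective (fderiv ℂ f z) := by
      intro z
      have h1 : Function.Injective (fderiv ℂ f z) ↔ Function.Injective (A z) := by
        simp only [A, ContinuousLinearMap.coe_comp, ContinuousLinearEquiv.coe_coe]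
        exact (L.injective.of_comp_iff _).symm
      rw [h1, ← not_iff_not, not_not, iff_comm]
      have h2 : Function.Injective (A z) ↔ LinearMap.ker (A z : E →ₗ[ℂ] E) = ⊥ :=
        LinearMap.ker_eq_bot.symm
      rw [h2]
      constructor
      · intro hk h0
        exact (LinearMap.bot_lt_ker_of_det_eq_zero h0).ne' hk
      · intro hdet
        exact (LinearMap.equivOfDetNeZero (A z : E →ₗ[ℂ] E) hdet).ker
    have hh : ∀ z, AnalyticAt ℂ f z → AnalyticAt ℂ h z := fun z hz =>
      AnalyticAt.clm_det ((((ContinuousLinearMap.compL ℂ E F E) (L : F →L[ℂ] E)).analyticAt _).comp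
        hz.fderiv)
    let W : Set E := {z | AnalyticAt ℂ f z ∧ s ∈ 𝓝 z}
    have hW : ∀ z ∈ W, W ∈ 𝓝 z := fun z hz =>
      hz.1.eventually_analyticAt.and (eventually_mem_nhds_iff.2 hz.2)
    have hWp : p ∈ W := ⟨hf, hs⟩
    have hW0 : ∀ z ∈ W, h z = 0 → fderiv ℂ f z = 0 := fun z hz hz0 =>
      stepA z hz.1 hz.2 ((hA z).1 hz0)
    have hne : ¬ ∀ᶠ z in 𝓝 p, h z = 0 := by
      intro hcon
      refine not_injOn_of_eventually_eq (hf.eventually_eq_of_fderiv_eq_zero ?_) hs hinj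
      filter_upwards [hcon, hW p hWp] with z hz hzW using hW0 z hzW hz
    obtain ⟨e, q, k, hqW, hq0, hhq, hkq, hhk, hke, hline⟩ :=
      (hh p hf).exists_defining_function ((hA p).2 hnot) hne (hW p hWp)
    have hk0 : k q = 0 := hhk.self_of_nhds hq0
    have hk' : fderiv ℂ k q ≠ 0 := by intro h0; rw [h0] at hke; exact hke rfl
    obtain ⟨ψ, hψ, hψ0, -, hψk, t, ht, hψt⟩ := hkq.exists_levelSet_parametrization rfl hk'
    let K := LinearMap.ker ((fderiv ℂ k q : E →L[ℂ] ℂ) : E →ₗ[ℂ] ℂ)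
    -- The dimension is at least two here, so the hypersurface has positive dimension; this is why
    -- dimension one was split off.
    have hKn : Nontrivial K := finrank_pos_iff (R := ℂ).1 (by
      have h1 := finrank_ker_add_one hk'
      have h2 : finrank ℂ K + 1 = finrank ℂ E := h1
      omega)
    -- the zero sets of `h` and `k` agree near `q`
    have hkh : ∀ᶠ z in 𝓝 q, k z = 0 → h z = 0 := by
      have hc : ContinuousAt (fun y : E × ℂ => y.1 + y.2 • e) (q, 0) := by fun_prop
      have h1 : ∀ᶠ y : E × ℂ in 𝓝 (q, 0), h (y.1 + y.2 • e) = 0 → k (y.1 + y.2 • e) = 0 :=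
        hc.eventually (by simpa using hhk)
      have h2 := h1.and (hkq.eventually_eq_zero_of_line_eq hke)
      rw [nhds_prod_eq] at h2
      obtain ⟨P, hP, Q, hQ, hPQ⟩ := eventually_prod_iff.1 h2
      obtain ⟨r, hr, hrQ⟩ := Metric.nhds_basis_closedBall.eventually_iff.1 hQ
      filter_upwards [hP, hhq.eventually_exists_zero_on_line hq0 hline hr] with z hz hzt hkz
      obtain ⟨τ, hτ, hτ0⟩ := hzt
      -- The Hurwitz zero at parameter `τ` is also a zero of `k`, as is `z` itself; injectivity of
      -- `k` along `e` forces `τ = 0`, so `h z = 0`.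
      have h3 := hPQ hz (hrQ (show τ ∈ closedBall 0 r by simpa using hτ))
      have h4 : τ = 0 := h3.2 (by rw [h3.1 hτ0, hkz])
      simpa [h4] using hτ0
    have hψq : Tendsto ψ (𝓝 0) (𝓝 q) := by
      have := hψ.continuousAt.tendsto; rwa [hψ0] at this
    have hfψ : AnalyticAt ℂ (fun x => f (ψ x)) 0 := AnalyticAt.comp_of_eq hqW.1 hψ hψ0
    -- Along `k = 0` the determinant `h` vanishes, hence so does `f'`. Thus `f` is constant on the
    -- hypersurface, contradicting injectivity.
    refine not_injOn_of_eventually_eq (hfψ.eventually_eq_of_fderiv_eq_zero ?_)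
      (inter_mem ht (hψq (hqW.2))) (fun x hx y hy hxy => hψt hx.1 hy.1 (hinj hx.2 hy.2 hxy))
    filter_upwards [hψ.eventually_analyticAt, hψk, hψq.eventually hkh, hψq.eventually (hW q hqW)]
      with x hx hxk hxh hxW
    have h1 : fderiv ℂ f (ψ x) = 0 := hW0 _ hxW (hxh (by rw [hxk, hk0]))
    have h2 := hxW.1.differentiableAt.hasFDerivAt.comp x hx.differentiableAt.hasFDerivAt
    rw [h1, ContinuousLinearMap.zero_comp] at h2
    exact h2.fderiv

end InjectiveFDeriv

/-! ### Injective holomorphic maps between manifolds -/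

section Manifolds

open Set Filter Module

theorem isOpenMap_of_injective_of_finrank_eq {V W M N : Type*} [NormedAddCommGroup V]
    [NormedSpace ℝ V] [FiniteDimensional ℝ V] [NormedAddCommGroup W] [NormedSpace ℝ W]
    [FiniteDimensional ℝ W] (hdim : finrank ℝ V = finrank ℝ W) [TopologicalSpace M]
    [TopologicalSpace N] [ChartedSpace V M] [ChartedSpace W N] {f : M → N} (hf : Continuous f)
    (hinj : Function.Injective f) : IsOpenMap f := by
  rw [isOpenMap_iff_nhds_le]
  intro u s hs
  let a := chartAt V u
  let b := chartAt W (f u)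
  have hu : u ∈ a.source := mem_chart_source V u
  have hfu : f u ∈ b.source := mem_chart_source W (f u)
  let T : Set V := a.target ∩ a.symm ⁻¹' (f ⁻¹' (s ∩ b.source))
  have hT : T ∈ 𝓝 (a u) := by
    refine inter_mem (a.open_target.mem_nhds (a.map_source hu)) ?_
    refine (a.symm.continuousAt (a.map_source hu)).preimage_mem_nhds ?_
    rw [a.left_inv hu]
    exact inter_mem hs (hf.continuousAt.preimage_mem_nhds (b.open_source.mem_nhds hfu))
  have hcont : ContinuousOn (fun z => b (f (a.symm z))) T :=
    b.continuousOn.comp (hf.comp_continuousOn (a.continuousOn_symm.mono inter_subset_left))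
      fun z hz => hz.2.2
  have hTinj : InjOn (fun z => b (f (a.symm z))) T := fun z hz z' hz' h =>
    a.symm.injOn hz.1 hz'.1 (hinj (b.injOn hz.2.2 hz'.2.2 h))
  have h1 := hcont.image_mem_nhds_of_injOn hdim hTinj hT
  rw [show b (f (a.symm (a u))) = b (f u) by rw [a.left_inv hu]] at h1
  have h2 := b.symm.image_mem_nhds (b.map_source hfu) h1
  rw [b.left_inv hfu] at h2
  refine mem_of_superset h2 ?_
  rintro _ ⟨_, ⟨z, hz, rfl⟩, rfl⟩
  simpa [b.left_inv hz.2.2] using hz.2.1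

variable {n : ℕ}

local notation "𝔼" => EuclideanSpace ℂ (Fin n)

theorem finrank_real_euclideanSpace_complex :
    finrank ℝ 𝔼 = finrank ℝ (EuclideanSpace ℝ (Fin (2 * n))) := by
  rw [← finrank_mul_finrank ℝ ℂ 𝔼]
  simp

/-- An injective holomorphic map has local holomorphic right inverses. -/
theorem IsHolomorphic.exists_local_inverse {M N : Type*} [TopologicalSpace M] [TopologicalSpace N]
    [cM : ChartedSpace 𝔼 M] [cN : ChartedSpace 𝔼 N] (hM : IsComplexStructure n cM)
    (hN : IsComplexStructure n cN) {g : M → N} (hg : IsHolomorphic n g)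
    (hinj : Function.Injective g) (x : M) :
    ∃ H : N → M, ContMDiffAt 𝓘(ℂ, 𝔼) 𝓘(ℂ, 𝔼) ω H (g x) ∧ ∀ᶠ y in 𝓝 (g x), g (H y) = y := by
  have : IsManifold 𝓘(ℂ, 𝔼) ω M := hM
  have : IsManifold 𝓘(ℂ, 𝔼) ω N := hN
  let a := chartAt 𝔼 x
  let b := chartAt 𝔼 (g x)
  have hx : x ∈ a.source := mem_chart_source 𝔼 x
  have hgx : g x ∈ b.source := mem_chart_source 𝔼 (g x)
  have ha : a ∈ IsManifold.maximalAtlas 𝓘(ℂ, 𝔼) ω M := IsManifold.chart_mem_maximalAtlas x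
  have hb : b ∈ IsManifold.maximalAtlas 𝓘(ℂ, 𝔼) ω N := IsManifold.chart_mem_maximalAtlas (g x)
  have hax : a.symm (a x) = x := a.left_inv hx
  let φ : 𝔼 → 𝔼 := fun z => b (g (a.symm z))
  have hφ : ContDiffAt ℂ ω φ (a x) := by
    rw [← contMDiffAt_iff_contDiffAt]
    have h1 : ContMDiffAt 𝓘(ℂ, 𝔼) 𝓘(ℂ, 𝔼) ω (fun z => g (a.symm z)) (a x) :=
      ContMDiffAt.comp (a x) (hg _) (contMDiffAt_symm_of_mem_maximalAtlas ha (a.map_source hx))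
    refine ContMDiffAt.comp (a x) ?_ h1
    exact contMDiffAt_of_mem_maximalAtlas hb (by rwa [hax])
  let s : Set 𝔼 := a.target ∩ a.symm ⁻¹' (g ⁻¹' b.source)
  have hgc : Continuous g := ContMDiff.continuous hg
  have hs : s ∈ 𝓝 (a x) := by
    refine inter_mem (a.open_target.mem_nhds (a.map_source hx)) ?_
    refine (a.symm.continuousAt (a.map_source hx)).preimage_mem_nhds ?_
    rw [hax]
    exact hgc.continuousAt.preimage_mem_nhds (b.open_source.mem_nhds hgx)
  have hsinj : InjOn φ s := fun z hz z' hz' h =>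
    a.symm.injOn hz.1 hz'.1 (hinj (b.injOn hz.2 hz'.2 h))
  -- Osgood's theorem in charts: the derivative is an injective endomorphism, hence invertible, and
  -- the inverse function theorem applies.
  have hfd := AnalyticAt.injective_fderiv_of_injOn n 𝔼 𝔼 (by simp) (by simp) φ (a x)
    hφ.analyticAt s hs hsinj
  let D : 𝔼 ≃L[ℂ] 𝔼 := (LinearEquiv.ofInjectiveEndo
    (fderiv ℂ φ (a x) : 𝔼 →ₗ[ℂ] 𝔼) hfd).toContinuousLinearEquiv
  have hω : (ω : WithTop ℕ∞) ≠ 0 := by simp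
  have hD : HasFDerivAt φ (D : 𝔼 →L[ℂ] 𝔼) (a x) := by
    have h1 : (D : 𝔼 →L[ℂ] 𝔼) = fderiv ℂ φ (a x) := by ext1 v; rfl
    rw [h1]
    exact (hφ.differentiableAt hω).hasFDerivAt
  let χ := hφ.localInverse hD hω
  have hφx : φ (a x) = b (g x) := by simp only [φ, hax]
  have hχ : ContDiffAt ℂ ω χ (b (g x)) := hφx ▸ hφ.to_localInverse hD hω
  have hχx : χ (b (g x)) = a x := hφx ▸ hφ.localInverse_apply_image hD hω
  have hr : ∀ᶠ w in 𝓝 (b (g x)), φ (χ w) = w :=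
    hφx ▸ (hφ.hasStrictFDerivAt' hD hω).eventually_right_inverse
  have hχs : ∀ᶠ w in 𝓝 (b (g x)), χ w ∈ s :=
    hχ.continuousAt.eventually (by rw [hχx]; exact hs)
  refine ⟨fun y => a.symm (χ (b y)), ?_, ?_⟩
  · have h1 : ContMDiffAt 𝓘(ℂ, 𝔼) 𝓘(ℂ, 𝔼) ω (fun y => χ (b y)) (g x) :=
      ContMDiffAt.comp (g x) hχ.contMDiffAt (contMDiffAt_of_mem_maximalAtlas hb hgx)
    refine ContMDiffAt.comp (g x) ?_ h1
    refine contMDiffAt_symm_of_mem_maximalAtlas ha ?_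
    rw [hχx]
    exact a.map_source hx
  · have hbc : ContinuousAt b (g x) := b.continuousAt hgx
    filter_upwards [hbc.eventually (hr.and hχs), b.open_source.mem_nhds hgx] with y hy hyb
    exact b.injOn hy.2.2 hyb hy.1

theorem isHolomorphic_coe_comp_iff {M N : Type*} [TopologicalSpace M] [TopologicalSpace N]
    [ChartedSpace 𝔼 M] [ChartedSpace 𝔼 N] {O : Opens N} {φ : M → O} :
    IsHolomorphic n (fun x => (φ x : N)) ↔ IsHolomorphic n φ := by
  refine forall_congr' fun x => ?_
  exact ChartedSpace.liftPropWithinAt_subtypeVal_comp_iff φ univ x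

/-- An injective holomorphic map is biholomorphic onto its image. -/
theorem IsHolomorphic.isBiholomorphicOnto {M N : Type*} [TopologicalSpace M] [TopologicalSpace N]
    [cM : ChartedSpace 𝔼 M] [cN : ChartedSpace 𝔼 N] (hM : IsComplexStructure n cM)
    (hN : IsComplexStructure n cN) {g : M → N} (hg : IsHolomorphic n g)
    (hinj : Function.Injective g) {S : Set N} (hS : range g = S) : IsBiholomorphicOnto n g S := by
  subst hS
  have hgc : Continuous g := ContMDiff.continuous hg
  have hopen : IsOpenMap g := isOpenMap_of_injective_of_finrank_eq (V := 𝔼) (W := 𝔼) rfl hgc hinj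
  let φ : M ≃ (⟨range g, hopen.isOpen_range⟩ : Opens N) := Equiv.ofInjective g hinj
  have hφ : ∀ x, (φ x : N) = g x := fun x => rfl
  refine ⟨hopen.isOpen_range, φ, isHolomorphic_coe_comp_iff.1 hg, ?_, hφ⟩
  intro y
  obtain ⟨x, rfl⟩ := φ.surjective y
  obtain ⟨H, hH, hgH⟩ := hg.exists_local_inverse hM hN hinj x
  have h1 : ContMDiffAt 𝓘(ℂ, 𝔼) 𝓘(ℂ, 𝔼) ω
      (fun y : (⟨range g, hopen.isOpen_range⟩ : Opens N) => H y) (φ x) :=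
    contMDiffAt_subtype_iff.2 hH
  refine h1.congr_of_eventuallyEq ?_
  have hc : ContinuousAt (Subtype.val : (⟨range g, hopen.isOpen_range⟩ : Opens N) → N) (φ x) :=
    continuous_subtype_val.continuousAt
  filter_upwards [hc.eventually hgH] with y hy
  rw [Equiv.symm_apply_eq]
  exact Subtype.ext hy.symm

/-- By injectivity of `g`, the set-theoretic inverse agrees near each point with a local holomorphic
right inverse; continuity of `k` comes for free. -/
theorem IsHolomorphic.of_comp_eq_id {M N : Type*} [TopologicalSpace M] [TopologicalSpace N]
    [cM : ChartedSpace 𝔼 M] [cN : ChartedSpace 𝔼 N] (hM : IsComplexStructure n cM)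
    (hN : IsComplexStructure n cN) {g : M → N} (hg : IsHolomorphic n g) {k : N → M}
    (hkg : ∀ x, k (g x) = x) (hgk : ∀ y, g (k y) = y) : IsHolomorphic n k := by
  intro y
  have hinj : Function.Injective g := Function.LeftInverse.injective hkg
  obtain ⟨H, hH, hgH⟩ := hg.exists_local_inverse hM hN hinj (k y)
  rw [hgk] at hH hgH
  exact hH.congr_of_eventuallyEq (hgH.mono fun z hz => hinj (by rw [hgk, hz]))

/-- Meant for `g` and `k` the identity between two structures on one space; writing two types keeps
the structures apart. -/
theorem holomorphicAtlas_mem_of_comp {M N : Type*} [TopologicalSpace M] [TopologicalSpace N]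
    [cM : ChartedSpace 𝔼 M] [cN : ChartedSpace 𝔼 N] (hM : IsComplexStructure n cM)
    {g : M → N} {k : N → M} (hg : IsHolomorphic n g) (hk : IsHolomorphic n k)
    {e : OpenPartialHomeomorph M 𝔼} {e' : OpenPartialHomeomorph N 𝔼}
    (he' : e' ∈ holomorphicAtlas n cN) (hsource : MapsTo g e.source e'.source)
    (htarget : e.target ⊆ e'.target) (heq : ∀ x, e x = e' (g x))
    (heq' : ∀ z, e.symm z = k (e'.symm z)) : e ∈ holomorphicAtlas n cM := by
  have : IsManifold 𝓘(ℂ, 𝔼) ω M := hM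
  refine IsManifold.mem_maximalAtlas_iff_contMDiffOn e |>.2 ⟨?_, ?_⟩
  · exact (ContMDiffOn.comp (contMDiffOn_of_mem_maximalAtlas he') (ContMDiff.contMDiffOn hg)
      hsource).congr fun x _ => heq x
  · exact (ContMDiff.comp_contMDiffOn hk
      ((contMDiffOn_symm_of_mem_maximalAtlas he').mono htarget)).congr fun z _ => heq' z

/-- If the identity is holomorphic from one complex structure to another, then the two complex
structures coincide. -/
theorem holomorphicAtlas_eq_of_isHolomorphic_id {M : Type*} [TopologicalSpace M]
    {c c' : ChartedSpace 𝔼 M} (hc : IsComplexStructure n c) (hc' : IsComplexStructure n c')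
    (hid : @IsHolomorphic n M M _ _ c c' id) : holomorphicAtlas n c = holomorphicAtlas n c' := by
  have hinv : @IsHolomorphic n M M _ _ c' c id :=
    IsHolomorphic.of_comp_eq_id (cM := c) (cN := c') hc hc' hid (fun _ => rfl) (fun _ => rfl)
  ext e
  exact ⟨fun he => holomorphicAtlas_mem_of_comp (cM := c') (cN := c) hc' hinv hid he
      (fun _ h => h) subset_rfl (fun _ => rfl) (fun _ => rfl),
    fun he => holomorphicAtlas_mem_of_comp (cM := c) (cN := c') hc hid hinv he
      (fun _ h => h) subset_rfl (fun _ => rfl) (fun _ => rfl)⟩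

theorem isHolomorphic_of_charts {M N : Type*} [TopologicalSpace M] [TopologicalSpace N]
    [cM : ChartedSpace 𝔼 M] [cN : ChartedSpace 𝔼 N] {g : M → N}
    (h : ∀ x, ∃ e ∈ holomorphicAtlas n cM, ∃ e' ∈ holomorphicAtlas n cN, x ∈ e.source ∧
      e x ∈ e'.target ∧ ∀ y ∈ e.source, g y = e'.symm (e y)) : IsHolomorphic n g := by
  intro x
  obtain ⟨e, he, e', he', hx, hx', hg⟩ := h x
  refine ContMDiffAt.congr_of_eventuallyEq
    (ContMDiffAt.comp x (contMDiffAt_symm_of_mem_maximalAtlas he' hx')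
      (contMDiffAt_of_mem_maximalAtlas he hx)) ?_
  filter_upwards [e.open_source.mem_nhds hx] with y hy using hg y hy

theorem isHolomorphic_id_of_holomorphicAtlas_eq {M : Type*} [TopologicalSpace M]
    {c c' : ChartedSpace 𝔼 M} (hc : IsComplexStructure n c)
    (h : holomorphicAtlas n c = holomorphicAtlas n c') : @IsHolomorphic n M M _ _ c c' id := by
  refine isHolomorphic_of_charts (cM := c) (cN := c') fun x => ?_
  have he : @chartAt 𝔼 _ M _ c x ∈ holomorphicAtlas n c :=
    @IsManifold.chart_mem_maximalAtlas ℂ _ 𝔼 _ _ 𝔼 _ 𝓘(ℂ, 𝔼) ω M _ c hc x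
  have hx := @mem_chart_source 𝔼 M _ _ c x
  exact ⟨_, he, _, h ▸ he, hx, OpenPartialHomeomorph.map_source _ hx,
    fun y hy => (OpenPartialHomeomorph.left_inv _ hy).symm⟩

/-- A map is holomorphic if its compositions with jointly surjective injective holomorphic maps
are. -/
theorem isHolomorphic_of_comp {M N X Z : Type*} [TopologicalSpace M] [TopologicalSpace N]
    [TopologicalSpace X] [TopologicalSpace Z] [cM : ChartedSpace 𝔼 M] [cN : ChartedSpace 𝔼 N]
    [cX : ChartedSpace 𝔼 X] [cZ : ChartedSpace 𝔼 Z] (hM : IsComplexStructure n cM)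
    (hN : IsComplexStructure n cN) (hX : IsComplexStructure n cX) {j : M → X} {k : N → X}
    (hj : Function.Injective j) (hk : Function.Injective k)
    (hcov : ∀ x, x ∈ range j ∨ x ∈ range k) (hjX : IsHolomorphic n j) (hkX : IsHolomorphic n k)
    {g : X → Z} (hgj : IsHolomorphic n (fun x => g (j x)))
    (hgk : IsHolomorphic n (fun x => g (k x))) : IsHolomorphic n g := by
  intro x
  rcases hcov x with ⟨m, rfl⟩ | ⟨m, rfl⟩
  · obtain ⟨H, hH, hjH⟩ := hjX.exists_local_inverse hM hX hj m
    exact (ContMDiffAt.comp (j m) (hgj _) hH).congr_of_eventuallyEq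
      (hjH.mono fun y hy => congrArg g hy.symm)
  · obtain ⟨H, hH, hkH⟩ := hkX.exists_local_inverse hN hX hk m
    exact (ContMDiffAt.comp (k m) (hgk _) hH).congr_of_eventuallyEq
      (hkH.mono fun y hy => congrArg g hy.symm)

end Manifolds

/-! ### Gluing complex structures -/

section Gluing

open Set Filter Topology

variable {n : ℕ}

local notation "𝔼" => EuclideanSpace ℂ (Fin n)

/-- The local map `H` plays the role of `k⁻¹ ∘ j`, so the transition between transported charts is
locally `e' ∘ H ∘ e⁻¹`. Asking only for local lifts avoids defining `k⁻¹` globally. -/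
theorem contDiffOn_lift_openEmbedding_trans {M N X : Type*} [TopologicalSpace M]
    [TopologicalSpace N] [TopologicalSpace X] [cM : ChartedSpace 𝔼 M] [cN : ChartedSpace 𝔼 N]
    {j : M → X} {k : N → X} (hj : IsOpenEmbedding j) (hk : IsOpenEmbedding k)
    (hjk : ∀ m x, j m = k x → ∃ H : M → N, ContMDiffAt 𝓘(ℂ, 𝔼) 𝓘(ℂ, 𝔼) ω H m ∧
      ∀ᶠ y in 𝓝 m, k (H y) = j y)
    {e : OpenPartialHomeomorph M 𝔼} {e' : OpenPartialHomeomorph N 𝔼}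
    (he : e ∈ holomorphicAtlas n cM) (he' : e' ∈ holomorphicAtlas n cN) :
    ContDiffOn ℂ ω ((e.lift_openEmbedding hj).symm ≫ₕ e'.lift_openEmbedding hk)
      ((e.lift_openEmbedding hj).symm ≫ₕ e'.lift_openEmbedding hk).source := by
  rintro z ⟨hz, u, hu, hzu⟩
  have hz' : z ∈ e.target := hz
  have hzu' : k u = j (e.symm z) := hzu
  obtain ⟨H, hH, hkH⟩ := hjk (e.symm z) u hzu'.symm
  have hHz : H (e.symm z) = u := hk.injective (hkH.self_of_nhds.trans hzu'.symm)
  refine ContDiffAt.contDiffWithinAt ?_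
  have h1 : ContMDiffAt 𝓘(ℂ, 𝔼) 𝓘(ℂ, 𝔼) ω (fun w => H (e.symm w)) z :=
    ContMDiffAt.comp z hH (contMDiffAt_symm_of_mem_maximalAtlas he hz')
  have h2 : ContMDiffAt 𝓘(ℂ, 𝔼) 𝓘(ℂ, 𝔼) ω (fun w => e' (H (e.symm w))) z :=
    ContMDiffAt.comp z (contMDiffAt_of_mem_maximalAtlas he' (by rwa [hHz])) h1
  refine h2.contDiffAt.congr_of_eventuallyEq ?_
  filter_upwards [(e.symm.continuousAt hz').eventually hkH] with w hw
  show (e'.lift_openEmbedding hk) (j (e.symm w)) = _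
  rw [← hw, e'.lift_openEmbedding_apply hk]

/-- Gluing of complex structures along jointly surjective open embeddings. -/
theorem exists_complexStructure_of_openEmbeddings {M N X : Type*} [TopologicalSpace M]
    [TopologicalSpace N] [TopologicalSpace X] [cM : ChartedSpace 𝔼 M] [cN : ChartedSpace 𝔼 N]
    (hM : IsComplexStructure n cM) (hN : IsComplexStructure n cN)
    {j : M → X} {k : N → X} (hj : IsOpenEmbedding j) (hk : IsOpenEmbedding k)
    (hcov : ∀ x, x ∈ range j ∨ x ∈ range k)
    (hjk : ∀ m x, j m = k x → ∃ H : M → N, ContMDiffAt 𝓘(ℂ, 𝔼) 𝓘(ℂ, 𝔼) ω H m ∧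
      ∀ᶠ y in 𝓝 m, k (H y) = j y)
    (hkj : ∀ x m, k x = j m → ∃ H : N → M, ContMDiffAt 𝓘(ℂ, 𝔼) 𝓘(ℂ, 𝔼) ω H x ∧
      ∀ᶠ y in 𝓝 x, j (H y) = k y) :
    ∃ c : ChartedSpace 𝔼 X, IsComplexStructure n c ∧ IsHolomorphic n j ∧ IsHolomorphic n k := by
  classical
  have : IsManifold 𝓘(ℂ, 𝔼) ω M := hM
  have : IsManifold 𝓘(ℂ, 𝔼) ω N := hN
  have hchart : ∀ x, ∃ e : OpenPartialHomeomorph X 𝔼, x ∈ e.source ∧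
      e ∈ (fun e : OpenPartialHomeomorph M 𝔼 => e.lift_openEmbedding hj) '' cM.atlas ∪
        (fun e : OpenPartialHomeomorph N 𝔼 => e.lift_openEmbedding hk) '' cN.atlas := by
    intro x
    rcases hcov x with ⟨m, rfl⟩ | ⟨m, rfl⟩
    · exact ⟨_, mem_image_of_mem j (mem_chart_source 𝔼 m),
        Or.inl (mem_image_of_mem _ (chart_mem_atlas 𝔼 m))⟩
    · exact ⟨_, mem_image_of_mem k (mem_chart_source 𝔼 m),
        Or.inr (mem_image_of_mem _ (chart_mem_atlas 𝔼 m))⟩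
  choose ch hch hch' using hchart
  let c : ChartedSpace 𝔼 X :=
    { atlas := (fun e : OpenPartialHomeomorph M 𝔼 => e.lift_openEmbedding hj) '' cM.atlas ∪
        (fun e : OpenPartialHomeomorph N 𝔼 => e.lift_openEmbedding hk) '' cN.atlas
      chartAt := ch
      mem_chart_source := hch
      chart_mem_atlas := hch' }
  have hmaxM : ∀ e ∈ cM.atlas, e ∈ holomorphicAtlas n cM := fun e he =>
    IsManifold.subset_maximalAtlas he
  have hmaxN : ∀ e ∈ cN.atlas, e ∈ holomorphicAtlas n cN := fun e he =>
    IsManifold.subset_maximalAtlas he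
  have hc : IsManifold 𝓘(ℂ, 𝔼) ω X := by
    refine isManifold_of_contDiffOn _ _ _ ?_
    -- Two charts coming from the same piece use the identity as lift; mixed pairs use the given
    -- ones.
    rintro _ _ (⟨e, he, rfl⟩ | ⟨e, he, rfl⟩) (⟨e', he', rfl⟩ | ⟨e', he', rfl⟩)
    · simpa using contDiffOn_lift_openEmbedding_trans hj hj
        (fun m x _ => ⟨id, contMDiffAt_id, Eventually.of_forall fun _ => rfl⟩)
        (hmaxM e he) (hmaxM e' he')
    · simpa using contDiffOn_lift_openEmbedding_trans hj hk hjk (hmaxM e he) (hmaxN e' he')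
    · simpa using contDiffOn_lift_openEmbedding_trans hk hj hkj (hmaxN e he) (hmaxM e' he')
    · simpa using contDiffOn_lift_openEmbedding_trans hk hk
        (fun m x _ => ⟨id, contMDiffAt_id, Eventually.of_forall fun _ => rfl⟩)
        (hmaxN e he) (hmaxN e' he')
  refine ⟨c, hc, isHolomorphic_of_charts fun x => ?_, isHolomorphic_of_charts fun x => ?_⟩
  · have hx := mem_chart_source 𝔼 x
    refine ⟨_, hmaxM _ (chart_mem_atlas 𝔼 x), (chartAt 𝔼 x).lift_openEmbedding hj,
      IsManifold.subset_maximalAtlas (Or.inl (mem_image_of_mem _ (chart_mem_atlas 𝔼 x))), hx,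
      (chartAt 𝔼 x).map_source hx, fun y hy => ?_⟩
    exact congrArg j ((chartAt 𝔼 x).left_inv hy).symm
  · have hx := mem_chart_source 𝔼 x
    refine ⟨_, hmaxN _ (chart_mem_atlas 𝔼 x), (chartAt 𝔼 x).lift_openEmbedding hk,
      IsManifold.subset_maximalAtlas (Or.inr (mem_image_of_mem _ (chart_mem_atlas 𝔼 x))), hx,
      (chartAt 𝔼 x).map_source hx, fun y hy => ?_⟩
    exact congrArg k ((chartAt 𝔼 x).left_inv hy).symm

theorem IsComplexStructure.opens {M : Type*} [TopologicalSpace M] {c : ChartedSpace 𝔼 M}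
    (hc : IsComplexStructure n c) (O : Opens M) : IsComplexStructure n (inducedCharts n c O) := by
  have : IsManifold 𝓘(ℂ, 𝔼) ω M := hc
  exact (inferInstance : IsManifold 𝓘(ℂ, 𝔼) ω O)

/-- A complex structure on `X` restricts to `cY` on `Y` if and only if the inclusion of `Y` is
holomorphic. -/
theorem extendsComplexStructure_iff {X : Type*} [TopologicalSpace X] {Y : Opens X}
    {cY : ChartedSpace 𝔼 Y} {c : ChartedSpace 𝔼 X} (hY : IsComplexStructure n cY)
    (hc : IsComplexStructure n c) :
    ExtendsComplexStructure n cY c ↔ @IsHolomorphic n Y X _ _ cY c Subtype.val := by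
  constructor
  · intro h
    have h2 := isHolomorphic_id_of_holomorphicAtlas_eq hY (h : _ = _).symm
    exact (@isHolomorphic_coe_comp_iff n Y X _ _ cY c Y id).2 h2
  · intro h
    have h2 := (@isHolomorphic_coe_comp_iff n Y X _ _ cY c Y id).1 h
    exact (holomorphicAtlas_eq_of_isHolomorphic_id hY (hc.opens Y) h2).symm

theorem IsBiholomorphicOnto.isHolomorphic {M N : Type*} [TopologicalSpace M] [TopologicalSpace N]
    [cM : ChartedSpace 𝔼 M] [cN : ChartedSpace 𝔼 N] {g : M → N} {S : Set N}
    (h : IsBiholomorphicOnto n g S) : IsHolomorphic n g := by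
  obtain ⟨hS, φ, hφ, -, hg⟩ := h
  have h1 := isHolomorphic_coe_comp_iff.2 hφ
  simpa only [hg] using h1

end Gluing

/-! ### Assembly of the theorem -/

theorem mainTheorem9 (n : ℕ) {X U : Type*}
    [TopologicalSpace X] [ChartedSpace (EuclideanSpace ℝ (Fin (2 * n))) X]
    (Y : Opens X) [cY : ChartedSpace (EuclideanSpace ℂ (Fin n)) Y]
    (hY : IsComplexStructure n cY)
    [TopologicalSpace U] [cU : ChartedSpace (EuclideanSpace ℂ (Fin n)) U]
    (hU : IsComplexStructure n cU)
    (f : C(U, X)) (hinj : Function.Injective f)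
    (hcover : (Y : Set X)ᶜ ⊆ Set.range f)
    (hhol : IsHolomorphic n (restrictToPreimage f Y)) :
    (IsOpen (Set.range f) ∧ Set.range f ∈ 𝓝ˢ ((Y : Set X)ᶜ)) ∧
    IsHomeomorph (Set.rangeFactorization f) ∧
    IsBiholomorphicOnto n (restrictToPreimage f Y) {y : Y | (y : X) ∈ Set.range f} ∧
    ∃ c : ChartedSpace (EuclideanSpace ℂ (Fin n)) X,
      (IsComplexStructure n c ∧ ExtendsComplexStructure n cY c ∧
        IsBiholomorphicOnto n f (Set.range f)) ∧
      ∀ c' : ChartedSpace (EuclideanSpace ℂ (Fin n)) X,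
        (IsComplexStructure n c' ∧ ExtendsComplexStructure n cY c' ∧
          IsBiholomorphicOnto n f (Set.range f)) →
        holomorphicAtlas n c' = holomorphicAtlas n c := by
  have hopen : IsOpenMap f :=
    isOpenMap_of_injective_of_finrank_eq (V := EuclideanSpace ℂ (Fin n))
      finrank_real_euclideanSpace_complex f.continuous hinj
  have hemb : Topology.IsOpenEmbedding f := .of_continuous_injective_isOpenMap f.continuous hinj hopen
  have hYemb : Topology.IsOpenEmbedding (Subtype.val : Y → X) := Y.2.isOpenEmbedding_subtypeVal
  have hV : IsComplexStructure n (inducedCharts n cU (Opens.comap f Y)) := hU.opens _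
  have hginj : Function.Injective (restrictToPreimage f Y) := fun u v h =>
    Subtype.ext (hinj (congrArg Subtype.val h))
  have hrange : Set.range (restrictToPreimage f Y) = {y : Y | (y : X) ∈ Set.range f} := by
    ext y
    constructor
    · rintro ⟨u, rfl⟩
      exact ⟨u, rfl⟩
    · rintro ⟨u, hu⟩
      exact ⟨⟨u, show f u ∈ Y from hu ▸ y.2⟩, Subtype.ext hu⟩
  have hcov : ∀ x, x ∈ Set.range (Subtype.val : Y → X) ∨ x ∈ Set.range f := by
    intro x
    by_cases hx : x ∈ Y
    · exact Or.inl ⟨⟨x, hx⟩, rfl⟩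
    · exact Or.inr (hcover hx)
  refine ⟨⟨hopen.isOpen_range, hopen.isOpen_range.mem_nhdsSet.2 hcover⟩,
    hemb.toIsEmbedding.toHomeomorph.isHomeomorph, hhol.isBiholomorphicOnto hV hY hginj hrange, ?_⟩
  obtain ⟨c, hc, hcY, hcf⟩ := exists_complexStructure_of_openEmbeddings hY hU hYemb hemb hcov
    (by
      intro y u hyu
      -- From `Y` to `U` the lift is a local inverse of `f`, holomorphic by Osgood's theorem.
      obtain ⟨H, hH, hgH⟩ := hhol.exists_local_inverse hV hY hginj
        ⟨u, show f u ∈ Y from hyu ▸ y.2⟩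
      have hy : restrictToPreimage f Y ⟨u, show f u ∈ Y from hyu ▸ y.2⟩ = y := Subtype.ext hyu.symm
      rw [hy] at hH hgH
      exact ⟨fun y => (H y : U), ContMDiffAt.comp y (contMDiff_subtype_val _) hH,
        hgH.mono fun z hz => congrArg Subtype.val hz⟩)
    (by
      classical
      intro u y huy
      have hu : f u ∈ Y := huy ▸ y.2
      -- From `U` to `Y` the lift is `f` itself; the default value `y` off `f⁻¹(Y)` does not affect
      -- the germ at `u`.
      let H : U → Y := fun v => if hv : f v ∈ Y then ⟨f v, hv⟩ else y
      have hH : ∀ v (hv : f v ∈ Y), H v = ⟨f v, hv⟩ := fun v hv => dif_pos hv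
      refine ⟨H, ?_, ?_⟩
      · refine (contMDiffAt_subtype_iff (U := Opens.comap f Y) (x := ⟨u, hu⟩)).1 ?_
        have h1 : (fun v : Opens.comap f Y => H v) = restrictToPreimage f Y :=
          funext fun v => hH v v.2
        rw [h1]
        exact hhol _
      · filter_upwards [(Opens.comap f Y).2.mem_nhds hu] with v hv
        rw [hH v hv])
  refine ⟨c, ⟨hc, (extendsComplexStructure_iff hY hc).2 hcY,
    hcf.isBiholomorphicOnto hU hc hinj rfl⟩, ?_⟩
  rintro c' ⟨hc', hcY', hcf'⟩
  -- The identity from `c` to `c'` is tested on `Y` and on `U`, where it becomes the inclusion and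
  -- `f`, both holomorphic for `c'`.
  refine (holomorphicAtlas_eq_of_isHolomorphic_id hc hc' ?_).symm
  exact isHolomorphic_of_comp (cX := c) (cZ := c') hY hU hc hYemb.injective hinj hcov hcY hcf
    ((extendsComplexStructure_iff hY hc').1 hcY') hcf'.isHolomorphic
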